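/- Let $(Y_p)_p$, indexed by the primes, be independent complex random variables on a probability space $(\Omega,\mathcal F,\mathbb P)$, each uniformly distributed on the unit circle, and for $n\ge 1$ put $$X_n=-\sum_{p\le n}\log\Bigl(1-\frac{Y_p}{\sqrt p}\Bigr)$$ (sum over primes $p\le n$, principal branch of the logarithm). Identify $\mathbb C$ with $\mathbb R^2$, let $\varphi_n(t)=\mathbb E[e^{i t\cdot X_n}]$ be the characteristic function of $X_n$, let $\varphi(t)=e^{-|t|^2/2}$ be that of the standard Gaussian measure on $\mathbb R^2$, and for $n\ge 3$ let $a_n=\sqrt{\tfrac12\log\log n}>0$. (1) There is mod-$\varphi$ (mod-Gaussian) convergence for $(X_n)_{n\ge 3}$ with respect to the linear maps $A_n=a_n\,\mathrm{Id}$ of $\mathbb R^2$ and their inverses $\Sigma_n=a_n^{-1}\mathrm{Id}$. That is: $\varphi$ is Lebesgue integrable on $\mathbb R^2$; $\Sigma_n\to 0$ and $\varphi_n(\Sigma_n^*t)\to\varphi(t)$ uniformly for $t$ in compact subsets of $\mathbb R^2$; and for every $k\ge 0$ $$\lim_{a\to+\infty}\ \sup_{n\ge 3}\int_{|t|\ge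 a}|\varphi_n(\Sigma_n^*t)|\,\mathbf 1_{|\Sigma_n^*t|\le k}\,dt=0 .$$ (2) For every bounded Jordan-measurable set $B\subset\mathbb C$ (a bounded set whose boundary has Lebesgue measure $0$), $$\lim_{n\to+\infty}\frac{\log\log n}{2}\,\mathbb P[X_n\in B]=\frac{m(B)}{2\pi},$$ where $m$ is Lebesgue measure on $\mathbb C$. (If $B$ is not a Borel set, $\mathbb P[X_n\in B]$ and $m(B)$ are understood as outer measures.) -/

import Mathlib

open MeasureTheory ProbabilityTheory Filter Topology
open scoped ENNReal

/-- Mod-`φ` convergence of a sequence `X` of random variables with values in a finite-dimensional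
Euclidean space `E`, where `φ = charFun μ` is the characteristic function of the probability
measure `μ`, relative to the linear automorphisms `A n` of `E` with inverses `S n`. -/
structure ModPhiConvergence {Ω E : Type*} [MeasurableSpace Ω]
    [NormedAddCommGroup E] [InnerProductSpace ℝ E] [FiniteDimensional ℝ E]
    [MeasurableSpace E] [BorelSpace E]
    (P : Measure Ω) (μ : Measure E) [IsProbabilityMeasure μ]
    (X : ℕ → Ω → E) (A S : ℕ → E →L[ℝ] E) : Prop where
  aemeasurable : ∀ n, AEMeasurable (X n) P
  left_inv : ∀ n, S n ∘L A n = ContinuousLinearMap.id ℝ E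
  right_inv : ∀ n, A n ∘L S n = ContinuousLinearMap.id ℝ E
  /-- The characteristic function of `μ` is Lebesgue integrable. -/
  integrable_charFun : Integrable (charFun μ) (volume : Measure E)
  tendsto_zero : Tendsto S atTop (𝓝 0)
  /-- `φ_n (S_n^* t) → φ t`, uniformly on compact sets. -/
  tendsto_charFun : ∀ K : Set E, IsCompact K →
    TendstoUniformlyOn
      (fun n t => charFun (P.map (X n)) (ContinuousLinearMap.adjoint (S n) t))
      (charFun μ) atTop K
  /-- For each `k ≥ 0`, the functions `t ↦ φ_n (S_n^* t) 1_{|S_n^* t| ≤ k}` are uniformly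
  integrable: their integrals over `|t| ≥ a` tend to `0` as `a → ∞`, uniformly in `n`. -/
  uniformly_integrable : ∀ k : ℝ, 0 ≤ k →
    Tendsto
      (fun a : ℝ => ⨆ n : ℕ,
        ∫⁻ t in {t : E | a ≤ ‖t‖ ∧ ‖ContinuousLinearMap.adjoint (S n) t‖ ≤ k},
          ‖charFun (P.map (X n)) (ContinuousLinearMap.adjoint (S n) t)‖ₑ)
      atTop (𝓝 (0 : ℝ≥0∞))

/-- The uniform probability measure on the unit circle of `ℂ`: the law of `exp (iθ)` for `θ`
uniformly distributed on `(-π, π]`. -/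
noncomputable def uniformUnitCircle : Measure ℂ :=
  (cond (volume : Measure ℝ) (Set.Ioc (-Real.pi) Real.pi)).map
    (fun θ : ℝ => Complex.exp (θ * Complex.I))

/-- `X_n = -∑_{p ≤ n} log (1 - Y_p / √p)`, the sum being over primes, with the principal branch
of the logarithm. -/
noncomputable def zetaModel {Ω : Type*} (Y : Nat.Primes → Ω → ℂ) (n : ℕ) (ω : Ω) : ℂ :=
  -∑ p ∈ (Finset.range (n + 1)).subtype Nat.Prime,
    Complex.log (1 - Y p ω / (Real.sqrt ((p : ℕ) : ℝ) : ℂ))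

/-- The scaling `√(log log n / 2)`. -/
noncomputable def zetaScale (n : ℕ) : ℝ :=
  Real.sqrt (Real.log (Real.log (n : ℝ)) / 2)

/-- Bounded Jordan-measurable subsets of the plane: bounded sets whose boundary has Lebesgue
measure zero. -/
def IsBoundedJordanMeasurable (B : Set ℂ) : Prop :=
  Bornology.IsBounded B ∧ volume (frontier B) = 0

/-!
The characteristic function of `X_n` is the product over the primes `p ≤ n` of the characteristic
functions of the Euler factors `-log (1 - Y_p / √p)`, where `Y_p` is uniform on the unit circle.
The logarithm is holomorphic on the closed disc and vanishes at the origin, so by the mean value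
property each factor is centred; its second moment is `1 / p` to leading order, and a Taylor
expansion gives `1 - |s|² / (4 p) + O(|s|² (1 + |s|) p^(-3/2))` for its characteristic function
(`norm_charFun_factor_sub_le`). The errors are summable over `p`, so the product is close to
`exp (-(|s|² / 4) ∑_{p ≤ n} 1 / p)`, and Mertens' estimate `∑_{p ≤ n} 1 / p = log log n + O(1)`
(`exists_abs_sum_primesLE_one_div_sub_log_log_le`, deduced from Legendre's formula for `n!`,
Chebyshev's bound, and summation by parts) identifies the limit after scaling by
`√(log log n / 2)` (`tendstoUniformlyOn_charFun_scaled`).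

For `|s| ≤ k` the factors with `p` large in terms of `k` are at most `exp (-|s|² / (8 p))`, while
the others are at most `1`. Hence the rescaled characteristic functions are dominated by
`exp (-|u|² / 8)` on `|u| ≤ k a_n`, for `n` large in terms of `k`
(`eventually_norm_charFun_scaled_le`). This gives the uniform integrability; the finitely many
remaining `n` contribute nothing once the cut-off exceeds `k a_n`.

For the local limit theorem, let `h = 𝓕 g` with `g` continuous of compact support. By Parseval,
`a_n ^ d ∫ h dμ_n` is an integral of the rescaled characteristic function against
`g (· / a_n)`, up to normalisation, and dominated convergence gives its limit, a multiple of
`g 0 = ∫ h`. Choosing `h` to be the square of the real Fourier transform of a bump function, so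
that `h ≥ 0` and `h` is bounded below on a prescribed ball, and applying this to `h` times a
character, Lévy's theorem shows that the measures `h μ_n`, normalised, converge weakly to `h` times
Lebesgue measure. Dividing by `h` gives convergence against continuous functions of compact support
(`tendsto_pow_mul_integral_of_hasCompactSupport`), and a bounded set with negligible boundary is
squeezed between such functions (`tendsto_mul_measureReal_of_frontier`).
-/

/-! ### Mertens' estimate for the reciprocals of the primes -/

/-- `∑ p^(-3/2)` over the primes up to `n` is bounded. -/
lemma exists_sum_primesLE_rpow_le :
    ∃ C : ℝ, 0 ≤ C ∧ ∀ n : ℕ, ∑ p ∈ n.primesLE, (p : ℝ) ^ (-(3 / 2) : ℝ) ≤ C := by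
  have hs : Summable fun m : ℕ => (m : ℝ) ^ (-(3 / 2) : ℝ) :=
    Real.summable_nat_rpow.2 (by norm_num)
  exact ⟨∑' m : ℕ, (m : ℝ) ^ (-(3 / 2) : ℝ), tsum_nonneg fun _ => by positivity,
    fun n => hs.sum_le_tsum _ fun _ _ => by positivity⟩

lemma Real.log_factorial_eq_sum_primesLE (n : ℕ) :
    Real.log (n.factorial : ℝ)
      = ∑ p ∈ n.primesLE, (n.factorial.factorization p : ℝ) * Real.log p := by
  rw [Real.log_nat_eq_sum_factorization]
  refine Finsupp.sum_of_support_subset _ (fun p hp => ?_) _ (by simp)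
  rw [Nat.support_factorization, Nat.mem_primeFactors] at hp
  exact Nat.mem_primesLE.2 ⟨(hp.1.dvd_factorial).1 hp.2.1, hp.1⟩

lemma Nat.div_le_factorization_factorial {n p : ℕ} (hp : p.Prime) :
    n / p ≤ n.factorial.factorization p := by
  rw [Nat.factorization_factorial hp (show Nat.log p n < Nat.log p n + 2 by omega)]
  simpa using Finset.single_le_sum (f := fun i => n / p ^ i) (fun _ _ => Nat.zero_le _)
    (show 1 ∈ Finset.Ico 1 (Nat.log p n + 2) by simp)

lemma Real.log_factorial_le_mul_log (n : ℕ) :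
    Real.log (n.factorial : ℝ) ≤ n * Real.log n := by
  rw [← Real.log_pow]
  exact Real.log_le_log (by exact_mod_cast n.factorial_pos)
    (by exact_mod_cast n.factorial_le_pow)

lemma Real.mul_log_sub_le_log_factorial {n : ℕ} (hn : n ≠ 0) :
    n * Real.log n - n ≤ Real.log (n.factorial : ℝ) := by
  have h := Stirling.le_log_factorial_stirling hn
  have h1 : 0 ≤ Real.log n := Real.log_natCast_nonneg n
  have h2 : 0 ≤ Real.log (2 * Real.pi) := Real.log_nonneg (by linarith [Real.pi_gt_three])
  linarith

/-- Mertens' first theorem, `∑_{p ≤ n} (log p) / p = log n + O(1)`. It follows from Legendre's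
formula for `n!` and Chebyshev's bound for `θ`. -/
lemma exists_abs_sum_primesLE_log_div_sub_log_le :
    ∃ C : ℝ, 0 ≤ C ∧ ∀ n : ℕ, n ≠ 0 →
      |∑ p ∈ n.primesLE, Real.log p / p - Real.log n| ≤ C := by
  obtain ⟨D, hD0, hD⟩ := exists_sum_primesLE_rpow_le
  refine ⟨max (Real.log 4) (4 * D + 1), by positivity, fun n hn => ?_⟩
  have hn0 : (0 : ℝ) < n := by positivity
  rw [abs_le]
  constructor
  -- Lower bound: `v_p (n!) ≤ n / (p - 1)`, and replacing `p - 1` by `p` costs a convergent series.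
  · have key : Real.log (n.factorial : ℝ)
        ≤ n * (∑ p ∈ n.primesLE, Real.log p / p + 4 * D) := by
      rw [Real.log_factorial_eq_sum_primesLE]
      calc _ ≤ ∑ p ∈ n.primesLE,
            (n : ℝ) * (Real.log p / p + 4 * (p : ℝ) ^ (-(3 / 2) : ℝ)) := by
            refine Finset.sum_le_sum fun p hp => ?_
            have hp' := Nat.prime_of_mem_primesLE hp
            have hp2 : (2 : ℝ) ≤ p := by exact_mod_cast hp'.two_le
            have h1 : (n.factorial.factorization p : ℝ) ≤ n / ((p : ℝ) - 1) := by
              have := Nat.factorization_factorial_le_div_pred hp' n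
              calc (n.factorial.factorization p : ℝ) ≤ ((n / (p - 1) : ℕ) : ℝ) := by
                    exact_mod_cast this
                _ ≤ (n : ℝ) / ((p - 1 : ℕ) : ℝ) := Nat.cast_div_le
                _ = _ := by rw [Nat.cast_sub hp'.one_lt.le, Nat.cast_one]
            have hl0 : 0 ≤ Real.log p := Real.log_natCast_nonneg p
            have hl : Real.log p ≤ 2 * (p : ℝ) ^ (1 / 2 : ℝ) := by
              have := Real.log_le_rpow_div (x := p) (by positivity)
                (show (0 : ℝ) < 1 / 2 by norm_num)
              linarith
            have hpow : (p : ℝ) ^ (-(3 / 2) : ℝ) = (p : ℝ) ^ (1 / 2 : ℝ) / (p : ℝ) ^ 2 := by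
              rw [← Real.rpow_natCast, ← Real.rpow_sub (by linarith)]; norm_num
            have h2 : 1 / ((p : ℝ) - 1) ≤ 1 / p + 2 / (p : ℝ) ^ 2 := by
              rw [div_add_div _ _ (by positivity) (by positivity),
                div_le_div_iff₀ (by linarith) (by positivity)]
              nlinarith [mul_nonneg (by linarith : (0 : ℝ) ≤ p) (by linarith : (0 : ℝ) ≤ p - 2)]
            calc _ ≤ n / ((p : ℝ) - 1) * Real.log p := by gcongr
              _ = n * (1 / ((p : ℝ) - 1) * Real.log p) := by ring
              _ ≤ n * ((1 / p + 2 / (p : ℝ) ^ 2) * Real.log p) := by gcongr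
              _ = n * (Real.log p / p + 2 / (p : ℝ) ^ 2 * Real.log p) := by ring
              _ ≤ n * (Real.log p / p + 2 / (p : ℝ) ^ 2 * (2 * (p : ℝ) ^ (1 / 2 : ℝ))) := by
                  gcongr
              _ = _ := by rw [hpow]; ring
        _ = n * (∑ p ∈ n.primesLE, Real.log p / p
              + 4 * ∑ p ∈ n.primesLE, (p : ℝ) ^ (-(3 / 2) : ℝ)) := by
            rw [← Finset.mul_sum, Finset.sum_add_distrib, Finset.mul_sum]
        _ ≤ _ := by gcongr; exact hD n
    have h3 := (Real.mul_log_sub_le_log_factorial hn).trans key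
    have h4 : Real.log n - 1 ≤ ∑ p ∈ n.primesLE, Real.log p / p + 4 * D := by
      refine le_of_mul_le_mul_left ?_ hn0
      linarith
    have := le_max_right (Real.log 4) (4 * D + 1)
    linarith
  -- Upper bound: `v_p (n!) ≥ n / p - 1`, and the terms `-1` add up to `-θ n`.
  · have key : n * (∑ p ∈ n.primesLE, Real.log p / p) - Real.log 4 * n
        ≤ Real.log (n.factorial : ℝ) := by
      have hθ : ∑ p ∈ n.primesLE, Real.log p ≤ Real.log 4 * n := by
        rw [← Chebyshev.theta_eq_sum_primesLE_log]
        exact Chebyshev.theta_le_log4_mul_x hn0.le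
      rw [Real.log_factorial_eq_sum_primesLE]
      calc _ ≤ n * (∑ p ∈ n.primesLE, Real.log p / p) - ∑ p ∈ n.primesLE, Real.log p := by
            linarith
        _ = ∑ p ∈ n.primesLE, ((n : ℝ) / p - 1) * Real.log p := by
            rw [Finset.mul_sum, ← Finset.sum_sub_distrib]
            exact Finset.sum_congr rfl fun p _ => by ring
        _ ≤ _ := by
            refine Finset.sum_le_sum fun p hp => ?_
            have hp' := Nat.prime_of_mem_primesLE hp
            refine mul_le_mul_of_nonneg_right ?_ (Real.log_natCast_nonneg p)
            have h1 : (n : ℝ) / p < (n / p : ℕ) + 1 := by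
              rw [← Nat.floor_div_eq_div (K := ℝ)]
              exact Nat.lt_floor_add_one _
            have h2 : ((n / p : ℕ) : ℝ) ≤ n.factorial.factorization p := by
              exact_mod_cast Nat.div_le_factorization_factorial hp'
            linarith
    have h3 := key.trans (Real.log_factorial_le_mul_log n)
    have h4 : ∑ p ∈ n.primesLE, Real.log p / p - Real.log 4 ≤ Real.log n := by
      refine le_of_mul_le_mul_left ?_ hn0
      linarith
    have := le_max_left (Real.log 4) (4 * D + 1)
    linarith

lemma Finset.sum_primesLE_succ (f : ℕ → ℝ) (n : ℕ) :
    ∑ p ∈ (n + 1).primesLE, f p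
      = ∑ p ∈ n.primesLE, f p + if (n + 1).Prime then f (n + 1) else 0 := by
  simp only [Nat.primesLE_eq_filter_range, Finset.sum_filter]
  rw [Finset.sum_range_succ]

/-- Mertens' second theorem, `∑_{p ≤ n} 1 / p = log log n + O(1)`. -/
theorem exists_abs_sum_primesLE_one_div_sub_log_log_le :
    ∃ C : ℝ, 0 ≤ C ∧ ∀ n : ℕ, 2 ≤ n →
      |∑ p ∈ n.primesLE, 1 / (p : ℝ) - Real.log (Real.log n)| ≤ C := by
  obtain ⟨C, hC0, hC⟩ := exists_abs_sum_primesLE_log_div_sub_log_le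
  set L : ℕ → ℝ := fun n => ∑ p ∈ n.primesLE, Real.log p / p with hL
  set R : ℕ → ℝ := fun n => ∑ p ∈ n.primesLE, 1 / (p : ℝ) with hR
  set D : ℕ → ℝ := fun n =>
    R n - Real.log (Real.log n) - (L n - Real.log n) / Real.log n with hDdef
  have hlog2 : 0 < Real.log 2 := Real.log_pos (by norm_num)
  have hlog : ∀ n : ℕ, 2 ≤ n → Real.log 2 ≤ Real.log n := fun n hn =>
    Real.log_le_log (by norm_num) (by exact_mod_cast hn)
  -- Summation by parts, done as an induction: `D` varies at most as `1 / log n` does.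
  have main : ∀ n : ℕ, 2 ≤ n →
      |D n| ≤ |D 2| + (1 + C) * (1 / Real.log 2 - 1 / Real.log n) := by
    intro n hn
    induction n, hn using Nat.le_induction with
    | base => simp
    | succ n hn ih =>
      have hx : 0 < Real.log n := hlog2.trans_le (hlog n hn)
      have hxy : Real.log n ≤ Real.log (n + 1 : ℕ) :=
        Real.log_le_log (by positivity) (by push_cast; linarith)
      have hy : 0 < Real.log (n + 1 : ℕ) := hx.trans_le hxy
      have hyx : Real.log (n + 1 : ℕ) - Real.log n ≤ 1 := by
        rw [← Real.log_div (by positivity) (by positivity)]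
        have hn1 : (1 : ℝ) ≤ n := by exact_mod_cast (by omega : 1 ≤ n)
        have h1 : ((n + 1 : ℕ) : ℝ) / n - 1 = 1 / n := by
          push_cast; field_simp; ring
        have h2 := Real.log_le_sub_one_of_pos (x := ((n + 1 : ℕ) : ℝ) / n) (by positivity)
        have h3 : 1 / (n : ℝ) ≤ 1 := by rw [div_le_one (by positivity)]; exact hn1
        linarith
      have hstep : R (n + 1) - R n = (L (n + 1) - L n) / Real.log (n + 1 : ℕ) := by
        simp only [hR, hL, Finset.sum_primesLE_succ (fun p => 1 / (p : ℝ)),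
          Finset.sum_primesLE_succ (fun p => Real.log p / (p : ℝ))]
        split_ifs
        · field_simp; ring
        · simp
      have hE := hC n (by omega)
      set x := Real.log n
      set y := Real.log (n + 1 : ℕ)
      have hq : 0 ≤ 1 / x - 1 / y := by
        have := one_div_le_one_div_of_le hx hxy
        linarith
      have hll : |(y - x) / y - (Real.log y - Real.log x)| ≤ 1 / x - 1 / y := by
        have h1 := Real.one_sub_inv_le_log_of_pos (x := y / x) (by positivity)
        have h2 := Real.log_le_sub_one_of_pos (x := y / x) (by positivity)
        rw [Real.log_div hy.ne' hx.ne'] at h1 h2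
        rw [inv_div] at h1
        have e1 : (y - x) / y = 1 - x / y := by field_simp
        have e2 : y / x - 1 - (1 - x / y) = (y - x) * (1 / x - 1 / y) := by
          field_simp
        have e3 : (y - x) * (1 / x - 1 / y) ≤ 1 * (1 / x - 1 / y) := by gcongr
        rw [abs_le]; constructor <;> linarith
      have hdiff : D (n + 1) - D n = ((y - x) / y - (Real.log y - Real.log x))
          + (L n - x) * (1 / x - 1 / y) := by
        have : R (n + 1) = R n + (L (n + 1) - L n) / y := by linarith
        simp only [hDdef]
        rw [this]
        change R n + (L (n + 1) - L n) / y - Real.log y - (L (n + 1) - y) / y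
          - (R n - Real.log x - (L n - x) / x) = _
        ring
      calc |D (n + 1)| = |D n + (D (n + 1) - D n)| := by ring_nf
        _ ≤ |D n| + |D (n + 1) - D n| := abs_add_le _ _
        _ ≤ |D n| + ((1 / x - 1 / y) + C * (1 / x - 1 / y)) := by
            gcongr
            rw [hdiff]
            refine (abs_add_le _ _).trans (add_le_add hll ?_)
            rw [abs_mul, abs_of_nonneg hq]
            gcongr
        _ ≤ _ := by linarith
  refine ⟨|D 2| + (1 + C) * (1 / Real.log 2) + C / Real.log 2, by positivity, fun n hn => ?_⟩
  have hx : 0 < Real.log n := hlog2.trans_le (hlog n hn)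
  have h1 : R n - Real.log (Real.log n) = D n + (L n - Real.log n) / Real.log n := by
    simp only [hDdef]; ring
  change |R n - Real.log (Real.log n)| ≤ _
  rw [h1]
  refine (abs_add_le _ _).trans (add_le_add ((main n hn).trans ?_) ?_)
  · gcongr
    have : 0 < 1 / Real.log n := by positivity
    linarith
  · rw [abs_div, abs_of_pos hx]
    exact div_le_div₀ hC0 (hC n (by omega)) hlog2 (hlog n hn)

/-! ### The characteristic function of a single Euler factor -/

lemma uniformUnitCircle_eq_smul_map :
    uniformUnitCircle = (ENNReal.ofReal (2 * Real.pi))⁻¹ •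
      (volume.restrict (Set.Ioc (-Real.pi) Real.pi)).map (circleMap 0 1) := by
  have : (fun θ : ℝ => Complex.exp (θ * Complex.I)) = circleMap 0 1 := by
    ext θ; simp [circleMap]
  rw [uniformUnitCircle, ProbabilityTheory.cond, Measure.map_smul, this, Real.volume_Ioc]
  congr 3; ring

instance : IsProbabilityMeasure uniformUnitCircle := by
  have : IsProbabilityMeasure (cond (volume : Measure ℝ) (Set.Ioc (-Real.pi) Real.pi)) :=
    cond_isProbabilityMeasure_of_finite (by simp [Real.pi_pos]) (by simp)
  exact Measure.isProbabilityMeasure_map (by fun_prop)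

lemma ae_norm_eq_one_uniformUnitCircle : ∀ᵐ y ∂uniformUnitCircle, ‖y‖ = 1 := by
  rw [uniformUnitCircle, ae_map_iff (by fun_prop)
    (measurableSet_eq_fun (by fun_prop) (by fun_prop))]
  exact ae_of_all _ fun θ => Complex.norm_exp_ofReal_mul_I θ

/-- The mean value property, as an integral against the uniform law of the unit circle. -/
lemma integral_uniformUnitCircle_eq_apply_zero {f : ℂ → ℂ} (hm : Measurable f)
    (hf : DiffContOnCl ℂ f (Metric.ball 0 1)) : ∫ y, f y ∂uniformUnitCircle = f 0 := by
  have h1 : Real.circleAverage f 0 1 = f 0 := DiffContOnCl.circleAverage (by simpa using hf)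
  rw [uniformUnitCircle_eq_smul_map, integral_smul_measure,
    integral_map (by fun_prop) hm.aestronglyMeasurable, ← h1, Real.circleAverage_def,
    ← intervalIntegral.integral_of_le (by linarith [Real.pi_pos])]
  have h2 := ((periodic_circleMap 0 1).comp f).intervalIntegral_add_eq (-Real.pi) 0
  simp only [Function.comp_apply, zero_add] at h2
  rw [← h2, ENNReal.toReal_inv, ENNReal.toReal_ofReal (by positivity)]
  congr 2; ring

/-- The logarithm of an Euler factor, `-log (1 - y / a)`. -/
noncomputable def eulerLog (a : ℝ) (y : ℂ) : ℂ := -Complex.log (1 - y / (a : ℂ))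

@[fun_prop]
lemma measurable_eulerLog (a : ℝ) : Measurable (eulerLog a) := by
  unfold eulerLog
  exact (Complex.measurable_log.comp (by fun_prop)).neg

/-- The bound `7 / 5` is a rational number below `√2`, the smallest value of `√p`. -/
lemma norm_eulerLog_sub_le {a : ℝ} (ha : 7 / 5 ≤ a) {y : ℂ} (hy : ‖y‖ = 1) :
    ‖eulerLog a y - y / a‖ ≤ 2 / a ^ 2 := by
  have ha0 : 0 < a := by linarith
  have hn : ‖-(y / (a : ℂ))‖ = 1 / a := by
    rw [norm_neg, norm_div, hy, Complex.norm_real, Real.norm_of_nonneg ha0.le]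
  have hr : 1 / a ≤ 5 / 7 := by
    rw [div_le_div_iff₀ ha0 (by norm_num)]; linarith
  have h := Complex.norm_log_one_add_sub_self_le (z := -(y / (a : ℂ))) (by rw [hn]; linarith)
  have e : eulerLog a y - y / a = -(Complex.log (1 + -(y / (a : ℂ))) - -(y / (a : ℂ))) := by
    rw [eulerLog, sub_eq_add_neg 1]; ring
  rw [e, norm_neg]
  refine h.trans ?_
  rw [hn]
  have h3 : (1 - 1 / a)⁻¹ ≤ 4 := by
    rw [inv_le_comm₀ (by linarith) (by norm_num)]; linarith
  calc (1 / a) ^ 2 * (1 - 1 / a)⁻¹ / 2 ≤ (1 / a) ^ 2 * 4 / 2 := by gcongr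
    _ = 2 / a ^ 2 := by field_simp; ring

lemma norm_eulerLog_le {a : ℝ} (ha : 7 / 5 ≤ a) {y : ℂ} (hy : ‖y‖ = 1) :
    ‖eulerLog a y‖ ≤ 3 / a := by
  have ha0 : 0 < a := by linarith
  have h := norm_eulerLog_sub_le ha hy
  have hn : ‖y / (a : ℂ)‖ = 1 / a := by
    rw [norm_div, hy, Complex.norm_real, Real.norm_of_nonneg ha0.le]
  have h2 : 2 / a ^ 2 ≤ 2 / a := by
    gcongr
    nlinarith
  calc ‖eulerLog a y‖ = ‖(eulerLog a y - y / a) + y / a‖ := by ring_nf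
    _ ≤ 2 / a ^ 2 + 1 / a := (norm_add_le _ _).trans (by rw [hn]; gcongr)
    _ ≤ 2 / a + 1 / a := by gcongr
    _ = 3 / a := by ring

lemma diffContOnCl_eulerLog {a : ℝ} (ha : 7 / 5 ≤ a) :
    DiffContOnCl ℂ (eulerLog a) (Metric.ball 0 1) := by
  have ha0 : 0 < a := by linarith
  refine DifferentiableOn.diffContOnCl ?_
  rw [closure_ball _ one_ne_zero]
  intro y hy
  rw [mem_closedBall_zero_iff] at hy
  have hmem : 1 - y / (a : ℂ) ∈ Complex.slitPlane := by
    rw [sub_eq_add_neg]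
    refine Complex.mem_slitPlane_of_norm_lt_one ?_
    rw [norm_neg, norm_div, Complex.norm_real, Real.norm_of_nonneg ha0.le, div_lt_one ha0]
    linarith
  have hd : DifferentiableAt ℂ (fun y : ℂ => Complex.log (1 - y / (a : ℂ))) y :=
    DifferentiableAt.clog (f := fun y : ℂ => 1 - y / (a : ℂ)) (by fun_prop) hmem
  exact hd.neg.differentiableWithinAt

lemma Complex.inner_eq_re_conj_mul (z s : ℂ) : inner ℝ z s = ((starRingEnd ℂ) s * z).re := by
  rw [Complex.inner]; simp

lemma integral_inner_uniformUnitCircle {f : ℂ → ℂ} (hm : Measurable f)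
    (hf : DiffContOnCl ℂ f (Metric.ball 0 1)) (hi : Integrable f uniformUnitCircle)
    (h0 : f 0 = 0) (s : ℂ) : ∫ y, inner ℝ (f y) s ∂uniformUnitCircle = 0 := by
  have h1 : ∫ y, (starRingEnd ℂ) s * f y ∂uniformUnitCircle = 0 := by
    rw [integral_const_mul, integral_uniformUnitCircle_eq_apply_zero hm hf, h0, mul_zero]
  simp_rw [Complex.inner_eq_re_conj_mul]
  have := integral_re (𝕜 := ℂ) (hi.const_mul ((starRingEnd ℂ) s))
  simp only [RCLike.re_eq_complex_re] at this
  rw [this, h1, Complex.zero_re]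

/-- The covariance of the uniform law on the unit circle is half the identity. -/
lemma integral_inner_sq_uniformUnitCircle (s : ℂ) :
    ∫ y, inner ℝ y s ^ 2 ∂uniformUnitCircle = ‖s‖ ^ 2 / 2 := by
  have hi : Integrable (fun y : ℂ => ((starRingEnd ℂ) s) ^ 2 * y ^ 2) uniformUnitCircle := by
    refine Integrable.const_mul (Integrable.of_bound (by fun_prop) 1 ?_) _
    filter_upwards [ae_norm_eq_one_uniformUnitCircle] with y hy
    simp [hy]
  have h1 : ∫ y : ℂ, ((starRingEnd ℂ) s) ^ 2 * y ^ 2 ∂uniformUnitCircle = 0 := by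
    rw [integral_const_mul, integral_uniformUnitCircle_eq_apply_zero (by fun_prop)
      (Differentiable.diffContOnCl (by fun_prop))]
    simp
  have h2 := integral_re (𝕜 := ℂ) hi
  simp only [RCLike.re_eq_complex_re] at h2
  rw [h1, Complex.zero_re] at h2
  have h3 : ∀ᵐ y ∂uniformUnitCircle, inner ℝ y s ^ 2
      = ‖s‖ ^ 2 / 2 + (((starRingEnd ℂ) s) ^ 2 * y ^ 2).re / 2 := by
    filter_upwards [ae_norm_eq_one_uniformUnitCircle] with y hy
    have hy2 : y.re ^ 2 + y.im ^ 2 = 1 := by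
      have := Complex.sq_norm y
      rw [hy, Complex.normSq_apply] at this
      linarith
    have hs2 : ‖s‖ ^ 2 = s.re ^ 2 + s.im ^ 2 := by
      rw [Complex.sq_norm, Complex.normSq_apply]; ring
    rw [Complex.inner_eq_re_conj_mul, hs2]
    simp only [pow_two, Complex.mul_re, Complex.mul_im, Complex.conj_re, Complex.conj_im]
    linear_combination ((s.re ^ 2 + s.im ^ 2) / 2) * hy2
  have h4 : Integrable (fun y : ℂ => (((starRingEnd ℂ) s) ^ 2 * y ^ 2).re / 2)
      uniformUnitCircle := hi.re.div_const 2
  rw [integral_congr_ae h3, integral_add (integrable_const _) h4, integral_div,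
    integral_div, h2]
  simp

lemma norm_exp_mul_I_sub_le (x : ℝ) :
    ‖Complex.exp (x * Complex.I) - (1 + x * Complex.I - x ^ 2 / 2)‖ ≤ 4 * |x| ^ 3 := by
  have hn : ‖(x : ℂ) * Complex.I‖ = |x| := by simp
  rcases le_total |x| 1 with h | h
  · have := Complex.exp_bound (x := x * Complex.I) (by rwa [hn]) (n := 3) (by norm_num)
    rw [hn] at this
    have e : ∑ m ∈ Finset.range 3, ((x : ℂ) * Complex.I) ^ m / (m.factorial : ℂ)
        = 1 + x * Complex.I - x ^ 2 / 2 := by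
      simp [Finset.sum_range_succ, mul_pow]; ring
    rw [e] at this
    refine this.trans ?_
    have hp : 0 ≤ |x| ^ 3 := by positivity
    norm_num [Nat.factorial]
    linarith
  · have h2 : 1 ≤ |x| ^ 2 := by nlinarith
    have h3 : |x| ^ 2 ≤ |x| ^ 3 := by nlinarith
    have h4 : |x| ≤ |x| ^ 2 := by nlinarith
    calc _ ≤ ‖Complex.exp (x * Complex.I)‖ + (‖(1 : ℂ)‖ + ‖(x : ℂ) * Complex.I‖
          + ‖(x : ℂ) ^ 2 / 2‖) :=
        (norm_sub_le _ _).trans (add_le_add le_rfl ((norm_sub_le _ _).trans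
          (add_le_add (norm_add_le _ _) le_rfl)))
      _ = 1 + (1 + |x| + |x| ^ 2 / 2) := by
        rw [Complex.norm_exp_ofReal_mul_I, hn]; simp
      _ ≤ _ := by linarith

/-- Second-order expansion of the characteristic function of the logarithm of an Euler factor.
The linear term vanishes exactly, by the mean value property, so that the error is quadratic
in `s`. -/
lemma norm_charFun_map_eulerLog_sub_le {a : ℝ} (ha : 7 / 5 ≤ a) (s : ℂ) :
    ‖charFun (uniformUnitCircle.map (eulerLog a)) s - ((1 - ‖s‖ ^ 2 / (4 * a ^ 2) : ℝ) : ℂ)‖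
      ≤ 112 * ‖s‖ ^ 2 * (1 + ‖s‖) / a ^ 3 := by
  have ha0 : 0 < a := by linarith
  have hint : Integrable (eulerLog a) uniformUnitCircle := by
    refine Integrable.of_bound (by fun_prop) (3 / a) ?_
    filter_upwards [ae_norm_eq_one_uniformUnitCircle] with y hy using norm_eulerLog_le ha hy
  have hx : ∫ y, inner ℝ (eulerLog a y) s ∂uniformUnitCircle = 0 :=
    integral_inner_uniformUnitCircle (by fun_prop) (diffContOnCl_eulerLog ha) hint
      (by simp [eulerLog]) s
  have hxi : Integrable (fun y => inner ℝ (eulerLog a y) s) uniformUnitCircle :=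
    hint.inner_const s
  have hyi : Integrable (fun y : ℂ => inner ℝ y s ^ 2) uniformUnitCircle := by
    refine Integrable.of_bound (by fun_prop) (‖s‖ ^ 2) ?_
    filter_upwards [ae_norm_eq_one_uniformUnitCircle] with y hy
    rw [norm_pow]
    gcongr
    simpa [hy] using norm_inner_le_norm (𝕜 := ℝ) y s
  have hg1 : Integrable (fun y : ℂ => (1 : ℂ) + (inner ℝ (eulerLog a y) s : ℝ) * Complex.I)
      uniformUnitCircle := (integrable_const _).add (hxi.ofReal.mul_const _)
  have hg2 : Integrable (fun y : ℂ => ((inner ℝ y s ^ 2 / (2 * a ^ 2) : ℝ) : ℂ))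
      uniformUnitCircle := (hyi.div_const _).ofReal
  have hg12 : Integrable (fun y : ℂ => (1 : ℂ) + (inner ℝ (eulerLog a y) s : ℝ) * Complex.I
      - ((inner ℝ y s ^ 2 / (2 * a ^ 2) : ℝ) : ℂ)) uniformUnitCircle := hg1.sub hg2
  have hmain : ∫ y : ℂ, ((1 : ℂ) + (inner ℝ (eulerLog a y) s : ℝ) * Complex.I
      - ((inner ℝ y s ^ 2 / (2 * a ^ 2) : ℝ) : ℂ)) ∂uniformUnitCircle
      = ((1 - ‖s‖ ^ 2 / (4 * a ^ 2) : ℝ) : ℂ) := by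
    rw [integral_sub hg1 hg2, integral_add (integrable_const _) (hxi.ofReal.mul_const _),
      integral_mul_const, integral_complex_ofReal, integral_complex_ofReal, hx, integral_div,
      integral_inner_sq_uniformUnitCircle]
    simp
    field_simp
    ring
  have hexp : Integrable (fun y : ℂ =>
      Complex.exp ((inner ℝ (eulerLog a y) s : ℝ) * Complex.I)) uniformUnitCircle := by
    refine Integrable.of_bound (by fun_prop) 1 (ae_of_all _ fun y => ?_)
    rw [Complex.norm_exp_ofReal_mul_I]
  rw [charFun_apply, integral_map (by fun_prop) (by fun_prop), ← hmain,
    ← integral_sub hexp hg12]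
  refine (norm_integral_le_of_norm_le_const (C := 112 * ‖s‖ ^ 2 * (1 + ‖s‖) / a ^ 3) ?_).trans
    (by simp)
  filter_upwards [ae_norm_eq_one_uniformUnitCircle] with y hy
  set x : ℝ := inner ℝ (eulerLog a y) s with hxdef
  set x₀ : ℝ := inner ℝ (y / (a : ℂ)) s with hx₀
  have hx0e : inner ℝ y s ^ 2 / (2 * a ^ 2) = x₀ ^ 2 / 2 := by
    have : x₀ = inner ℝ y s / a := by
      rw [hx₀, div_eq_inv_mul, ← Complex.ofReal_inv, ← Complex.real_smul, real_inner_smul_left,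
        div_eq_inv_mul]
    rw [this]; field_simp
  have hn : ‖y / (a : ℂ)‖ = 1 / a := by
    rw [norm_div, hy, Complex.norm_real, Real.norm_of_nonneg ha0.le]
  have b1 : |x| ≤ 3 / a * ‖s‖ :=
    (abs_real_inner_le_norm _ _).trans (by gcongr; exact norm_eulerLog_le ha hy)
  have b0 : |x₀| ≤ 1 / a * ‖s‖ := (abs_real_inner_le_norm _ _).trans (by rw [hn])
  have b2 : |x - x₀| ≤ 2 / a ^ 2 * ‖s‖ := by
    rw [hxdef, hx₀, ← inner_sub_left]
    exact (abs_real_inner_le_norm _ _).trans (by gcongr; exact norm_eulerLog_sub_le ha hy)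
  have b3 : |x ^ 2 - x₀ ^ 2| ≤ (2 / a ^ 2 * ‖s‖) * (4 / a * ‖s‖) := by
    rw [show x ^ 2 - x₀ ^ 2 = (x - x₀) * (x + x₀) by ring, abs_mul]
    gcongr
    refine (abs_add_le _ _).trans ((add_le_add b1 b0).trans (le_of_eq (by ring)))
  rw [hx0e]
  have e : Complex.exp (x * Complex.I) - ((1 : ℂ) + x * Complex.I - ((x₀ ^ 2 / 2 : ℝ) : ℂ))
      = (Complex.exp (x * Complex.I) - (1 + x * Complex.I - x ^ 2 / 2))
        + (((x₀ ^ 2 - x ^ 2) / 2 : ℝ) : ℂ) := by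
    push_cast; ring
  calc _ = ‖(Complex.exp (x * Complex.I) - (1 + x * Complex.I - x ^ 2 / 2))
        + (((x₀ ^ 2 - x ^ 2) / 2 : ℝ) : ℂ)‖ := by rw [← e]
    _ ≤ 4 * |x| ^ 3 + |x ^ 2 - x₀ ^ 2| / 2 := by
      refine (norm_add_le _ _).trans (add_le_add (norm_exp_mul_I_sub_le x) ?_)
      rw [Complex.norm_real, Real.norm_eq_abs, abs_div, abs_sub_comm, abs_two]
    _ ≤ 4 * (3 / a * ‖s‖) ^ 3 + (2 / a ^ 2 * ‖s‖) * (4 / a * ‖s‖) / 2 := by gcongr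
    _ = (108 * ‖s‖ ^ 3 + 4 * ‖s‖ ^ 2) / a ^ 3 := by ring
    _ ≤ _ := by
      gcongr
      nlinarith [sq_nonneg ‖s‖, norm_nonneg s, pow_nonneg (norm_nonneg s) 3]

/-! ### The characteristic function of the Euler product -/

lemma charFun_map_zetaModel {Ω : Type*} [MeasurableSpace Ω] {P : Measure Ω}
    [IsProbabilityMeasure P] {Y : Nat.Primes → Ω → ℂ} (hY_meas : ∀ p, Measurable (Y p))
    (hY_indep : iIndepFun Y P) (hY_unif : ∀ p, P.map (Y p) = uniformUnitCircle)
    (n : ℕ) (s : ℂ) :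
    charFun (P.map (zetaModel Y n)) s
      = ∏ p ∈ n.primesLE, charFun (uniformUnitCircle.map (eulerLog √p)) s := by
  obtain ⟨S, hS⟩ : ∃ S : Finset Nat.Primes, S = (Finset.range (n + 1)).subtype Nat.Prime :=
    ⟨_, rfl⟩
  have h1 : zetaModel Y n
      = fun ω => ∑ p ∈ S, (fun p : Nat.Primes => eulerLog √((p : ℕ) : ℝ) ∘ Y p) p ω := by
    ext ω
    rw [hS]
    simp only [zetaModel, eulerLog, Function.comp_apply]
    exact (Finset.sum_neg_distrib _).symm
  have hind : iIndepFun (fun p : Nat.Primes => eulerLog √((p : ℕ) : ℝ) ∘ Y p) P :=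
    hY_indep.comp (fun p : Nat.Primes => eulerLog √((p : ℕ) : ℝ)) fun _ => by fun_prop
  rw [h1, iIndepFun.charFun_map_fun_finsetSum_eq_prod
    (X := fun p : Nat.Primes => eulerLog √((p : ℕ) : ℝ) ∘ Y p)
    (fun p _ => ((measurable_eulerLog _).comp (hY_meas p)).aemeasurable) (hind.restrict _),
    Finset.prod_apply, Nat.primesLE_eq_filter_range, ← Finset.prod_subtype_eq_prod_filter, hS]
  refine Finset.prod_congr rfl fun p _ => ?_
  rw [← Measure.map_map (measurable_eulerLog _) (hY_meas p), hY_unif]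

lemma seven_fifths_le_sqrt {p : ℕ} (hp : p.Prime) : 7 / 5 ≤ √(p : ℝ) := by
  have : (2 : ℝ) ≤ p := by exact_mod_cast hp.two_le
  exact Real.le_sqrt_of_sq_le (by linarith)

lemma norm_charFun_factor_sub_le {p : ℕ} (hp : p.Prime) (s : ℂ) :
    ‖charFun (uniformUnitCircle.map (eulerLog √p)) s - ((1 - ‖s‖ ^ 2 / (4 * p) : ℝ) : ℂ)‖
      ≤ 112 * ‖s‖ ^ 2 * (1 + ‖s‖) * (p : ℝ) ^ (-(3 / 2) : ℝ) := by
  have h := norm_charFun_map_eulerLog_sub_le (seven_fifths_le_sqrt hp) s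
  have h3 : (√(p : ℝ) ^ 3)⁻¹ = (p : ℝ) ^ (-(3 / 2) : ℝ) := by
    rw [Real.sqrt_eq_rpow, ← Real.rpow_natCast, ← Real.rpow_mul (by positivity),
      ← Real.rpow_neg (by positivity)]
    norm_num
  rwa [Real.sq_sqrt (by positivity), div_eq_mul_inv _ (√(p : ℝ) ^ 3), h3] at h

lemma isProbabilityMeasure_map_eulerLog (a : ℝ) :
    IsProbabilityMeasure (uniformUnitCircle.map (eulerLog a)) :=
  Measure.isProbabilityMeasure_map (by fun_prop)

lemma norm_charFun_factor_le_one (a : ℝ) (s : ℂ) :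
    ‖charFun (uniformUnitCircle.map (eulerLog a)) s‖ ≤ 1 :=
  have := isProbabilityMeasure_map_eulerLog a
  norm_charFun_le_one s

/-- For primes that are large in terms of `k`, the characteristic function of an Euler factor has
Gaussian decay on the ball of radius `k`. -/
lemma norm_charFun_factor_le_exp {k : ℝ} {p : ℕ} (hp : p.Prime)
    (hpk : (896 * (1 + k)) ^ 2 ≤ p) {s : ℂ} (hs : ‖s‖ ≤ k) :
    ‖charFun (uniformUnitCircle.map (eulerLog √p)) s‖ ≤ Real.exp (-(‖s‖ ^ 2 / 8 * (1 / p))) := by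
  have hk : 0 ≤ k := (norm_nonneg s).trans hs
  have hp0 : (0 : ℝ) < p := by exact_mod_cast hp.pos
  have h3 : (p : ℝ) ^ (-(3 / 2) : ℝ) = (1 / p) * (1 / √p) := by
    rw [Real.sqrt_eq_rpow, one_div, one_div, ← Real.rpow_neg hp0.le, ← Real.rpow_neg_one,
      ← Real.rpow_add hp0]
    norm_num
  -- `896 = 8 * 112`, so that the error term takes up at most half of the main term
  have hsq : 896 * (1 + k) ≤ √p := Real.le_sqrt_of_sq_le hpk
  have hsp : 0 < √(p : ℝ) := Real.sqrt_pos.2 hp0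
  have h5 : 112 * (1 + k) * (1 / √p) ≤ 1 / 8 := by
    rw [mul_one_div, div_le_div_iff₀ hsp (by norm_num)]; linarith
  have h6 : ‖s‖ ^ 2 / (4 * p) ≤ 1 := by
    rw [div_le_one (by positivity)]
    have : ‖s‖ ^ 2 ≤ k ^ 2 := by gcongr
    nlinarith
  have h7 := norm_charFun_factor_sub_le hp s
  calc _ = ‖(charFun (uniformUnitCircle.map (eulerLog √p)) s
          - ((1 - ‖s‖ ^ 2 / (4 * p) : ℝ) : ℂ)) + ((1 - ‖s‖ ^ 2 / (4 * p) : ℝ) : ℂ)‖ := by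
        rw [sub_add_cancel]
    _ ≤ 112 * ‖s‖ ^ 2 * (1 + ‖s‖) * (p : ℝ) ^ (-(3 / 2) : ℝ) + (1 - ‖s‖ ^ 2 / (4 * p)) := by
        refine (norm_add_le _ _).trans (add_le_add h7 ?_)
        rw [Complex.norm_real, Real.norm_of_nonneg (by linarith)]
    _ ≤ ‖s‖ ^ 2 * (1 / p) * (112 * (1 + k) * (1 / √p)) + (1 - ‖s‖ ^ 2 / (4 * p)) := by
        rw [h3]
        have : 112 * ‖s‖ ^ 2 * (1 + ‖s‖) * (1 / p * (1 / √p))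
            ≤ 112 * ‖s‖ ^ 2 * (1 + k) * (1 / p * (1 / √(p : ℝ))) := by gcongr
        linarith
    _ ≤ ‖s‖ ^ 2 * (1 / p) * (1 / 8) + (1 - ‖s‖ ^ 2 / (4 * p)) := by gcongr
    _ = -(‖s‖ ^ 2 / 8 * (1 / p)) + 1 := by field_simp; ring
    _ ≤ _ := Real.add_one_le_exp _

lemma norm_prod_sub_prod_le_sum {ι : Type*} (S : Finset ι) (f g : ι → ℂ)
    (hf : ∀ i ∈ S, ‖f i‖ ≤ 1) (hg : ∀ i ∈ S, ‖g i‖ ≤ 1) :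
    ‖∏ i ∈ S, f i - ∏ i ∈ S, g i‖ ≤ ∑ i ∈ S, ‖f i - g i‖ := by
  classical
  induction S using Finset.induction_on with
  | empty => simp
  | insert a S ha ih =>
    simp only [Finset.forall_mem_insert] at hf hg
    rw [Finset.prod_insert ha, Finset.prod_insert ha, Finset.sum_insert ha]
    have h1 : ‖∏ i ∈ S, g i‖ ≤ 1 := by
      rw [norm_prod]
      exact Finset.prod_le_one (fun _ _ => norm_nonneg _) hg.2
    calc _ = ‖f a * (∏ i ∈ S, f i - ∏ i ∈ S, g i) + (f a - g a) * ∏ i ∈ S, g i‖ := by ring_nf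
      _ ≤ 1 * ∑ i ∈ S, ‖f i - g i‖ + ‖f a - g a‖ * 1 := by
        refine (norm_add_le _ _).trans (add_le_add ?_ ?_)
        · rw [norm_mul]
          exact mul_le_mul hf.1 (ih hf.2 hg.2) (norm_nonneg _) zero_le_one
        · rw [norm_mul]; gcongr
      _ = _ := by ring

lemma abs_one_sub_sub_exp_neg_le {x : ℝ} (hx : 0 ≤ x) : |1 - x - Real.exp (-x)| ≤ x ^ 2 := by
  have h1 := Real.add_one_le_exp (-x)
  have h2 := Real.add_one_le_exp x
  have h3 : Real.exp (-x) * Real.exp x = 1 := by rw [← Real.exp_add]; simp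
  have h4 := Real.exp_pos (-x)
  have h5 : Real.exp (-x) * (x + 1) ≤ 1 := 
    (mul_le_mul_of_nonneg_left h2 h4.le).trans_eq h3
  have h6 : Real.exp (-x) ≤ 1 - x + x ^ 2 := by
    have h7 : Real.exp (-x) * (x + 1) ≤ (1 - x + x ^ 2) * (x + 1) := by
      nlinarith [pow_nonneg hx 3]
    exact le_of_mul_le_mul_right h7 (by linarith)
  rw [abs_le]; constructor <;> nlinarith [sq_nonneg x]

lemma abs_exp_neg_sub_exp_neg_le {x y : ℝ} (hx : 0 ≤ x) (hy : 0 ≤ y) :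
    |Real.exp (-x) - Real.exp (-y)| ≤ |x - y| := by
  wlog h : x ≤ y generalizing x y
  · rw [abs_sub_comm, abs_sub_comm x]; exact this hy hx (le_of_not_ge h)
  have h1 := Real.add_one_le_exp (-(y - x))
  have h2 : Real.exp (-y) = Real.exp (-x) * Real.exp (-(y - x)) := by
    rw [← Real.exp_add]; ring_nf
  have h3 : Real.exp (-x) ≤ 1 := Real.exp_le_one_iff.2 (by linarith)
  have h4 : Real.exp (-y) ≤ Real.exp (-x) := Real.exp_le_exp.2 (by linarith)
  rw [abs_of_nonneg (by linarith), abs_of_nonpos (by linarith)]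
  nlinarith [Real.exp_pos (-x)]

section
variable {Ω : Type*} [MeasurableSpace Ω] {P : Measure Ω} [IsProbabilityMeasure P]
  {Y : Nat.Primes → Ω → ℂ}

/-- The characteristic function of `X_n` is compared with the Gaussian of variance
`(∑_{p ≤ n} 1 / p) / 2`. -/
lemma exists_norm_charFun_zetaModel_sub_exp_le (hY_meas : ∀ p, Measurable (Y p))
    (hY_indep : iIndepFun Y P) (hY_unif : ∀ p, P.map (Y p) = uniformUnitCircle) :
    ∃ D : ℝ, 0 ≤ D ∧ ∀ (n : ℕ) (s : ℂ),
      ‖charFun (P.map (zetaModel Y n)) s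
        - (Real.exp (-(‖s‖ ^ 2 / 4 * ∑ p ∈ n.primesLE, 1 / (p : ℝ))) : ℂ)‖
        ≤ (112 * ‖s‖ ^ 2 * (1 + ‖s‖) + ‖s‖ ^ 4) * D := by
  obtain ⟨D, hD0, hD⟩ := exists_sum_primesLE_rpow_le
  refine ⟨D, hD0, fun n s => ?_⟩
  rw [charFun_map_zetaModel hY_meas hY_indep hY_unif, Finset.mul_sum, ← Finset.sum_neg_distrib,
    Real.exp_sum, Complex.ofReal_prod]
  refine (norm_prod_sub_prod_le_sum _ _ _ (fun p _ => norm_charFun_factor_le_one _ s)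
    fun p _ => ?_).trans ?_
  · rw [Complex.norm_real, Real.norm_of_nonneg (Real.exp_pos _).le, Real.exp_le_one_iff]
    exact neg_nonpos.2 (by positivity)
  refine le_trans (b := ∑ p ∈ n.primesLE,
    (112 * ‖s‖ ^ 2 * (1 + ‖s‖) + ‖s‖ ^ 4) * (p : ℝ) ^ (-(3 / 2) : ℝ))
    (Finset.sum_le_sum fun p hp => ?_) ?_
  · have hp' := Nat.prime_of_mem_primesLE hp
    have hp1 : (1 : ℝ) ≤ p := by exact_mod_cast hp'.one_lt.le
    have h1 := norm_charFun_factor_sub_le hp' s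
    have h2 : ‖((1 - ‖s‖ ^ 2 / (4 * p) : ℝ) : ℂ)
        - (Real.exp (-(‖s‖ ^ 2 / 4 * (1 / (p : ℝ)))) : ℂ)‖
        ≤ ‖s‖ ^ 4 * (p : ℝ) ^ (-(3 / 2) : ℝ) := by
      rw [← Complex.ofReal_sub, Complex.norm_real, Real.norm_eq_abs,
        show ‖s‖ ^ 2 / (4 * (p : ℝ)) = ‖s‖ ^ 2 / 4 * (1 / (p : ℝ)) by ring]
      refine (abs_one_sub_sub_exp_neg_le (by positivity)).trans ?_
      have h3 : (p : ℝ) ^ (-2 : ℝ) ≤ (p : ℝ) ^ (-(3 / 2) : ℝ) :=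
        Real.rpow_le_rpow_of_exponent_le hp1 (by norm_num)
      have h4 : (p : ℝ) ^ (-2 : ℝ) = (1 / (p : ℝ)) ^ 2 := by
        rw [Real.rpow_neg (by positivity)]; simp
      calc (‖s‖ ^ 2 / 4 * (1 / (p : ℝ))) ^ 2 = ‖s‖ ^ 4 * (1 / (p : ℝ)) ^ 2 / 16 := by ring
        _ ≤ ‖s‖ ^ 4 * (1 / (p : ℝ)) ^ 2 := div_le_self (by positivity) (by norm_num)
        _ ≤ _ := by rw [← h4]; gcongr
    calc _ ≤ _ + _ := norm_sub_le_norm_sub_add_norm_sub _ _ _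
      _ ≤ _ := add_le_add h1 h2
      _ = _ := by ring
  · rw [← Finset.mul_sum]
    gcongr
    exact hD n

lemma tendsto_log_log_natCast_atTop :
    Tendsto (fun n : ℕ => Real.log (Real.log (n : ℝ))) atTop atTop :=
  Real.tendsto_log_atTop.comp (Real.tendsto_log_atTop.comp tendsto_natCast_atTop_atTop)

lemma eventually_norm_charFun_zetaModel_le (hY_meas : ∀ p, Measurable (Y p))
    (hY_indep : iIndepFun Y P) (hY_unif : ∀ p, P.map (Y p) = uniformUnitCircle) (k : ℝ) :
    ∀ᶠ n : ℕ in atTop, ∀ s : ℂ, ‖s‖ ≤ k →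
      ‖charFun (P.map (zetaModel Y n)) s‖
        ≤ Real.exp (-(‖s‖ ^ 2 / 16 * Real.log (Real.log n))) := by
  obtain ⟨C, hC0, hC⟩ := exists_abs_sum_primesLE_one_div_sub_log_log_le
  set m : ℕ := ⌈(896 * (1 + k)) ^ 2⌉₊ with hm
  filter_upwards [eventually_ge_atTop 2,
    tendsto_log_log_natCast_atTop.eventually_ge_atTop (2 * (C + m))] with n hn hll s hs
  rw [charFun_map_zetaModel hY_meas hY_indep hY_unif, norm_prod]
  -- the factors with `p < m` are bounded by `1`
  have h1 : ∏ p ∈ n.primesLE, ‖charFun (uniformUnitCircle.map (eulerLog √p)) s‖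
      ≤ ∏ p ∈ n.primesLE, Real.exp (-(‖s‖ ^ 2 / 8 * (1 / p - if p < m then 1 else 0))) := by
    refine Finset.prod_le_prod (fun _ _ => norm_nonneg _) fun p hp => ?_
    have hp' := Nat.prime_of_mem_primesLE hp
    have hp1 : (1 : ℝ) ≤ p := by exact_mod_cast hp'.one_lt.le
    split_ifs with h
    · refine (norm_charFun_factor_le_one _ s).trans (Real.one_le_exp ?_)
      have : 1 / (p : ℝ) ≤ 1 := by rw [div_le_one (by linarith)]; exact hp1
      have : 0 ≤ ‖s‖ ^ 2 / 8 * (1 - 1 / (p : ℝ)) := mul_nonneg (by positivity) (by linarith)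
      linarith
    · rw [sub_zero]
      refine norm_charFun_factor_le_exp hp' ?_ hs
      exact (Nat.le_ceil _).trans (by exact_mod_cast not_lt.1 h)
  refine h1.trans ?_
  rw [← Real.exp_sum, Finset.sum_neg_distrib, ← Finset.mul_sum, Finset.sum_sub_distrib]
  have h2 : ∑ p ∈ n.primesLE, (if p < m then (1 : ℝ) else 0) ≤ m := by
    rw [← Finset.sum_filter, Finset.sum_const, nsmul_eq_mul, mul_one]
    have h3 : (n.primesLE.filter (· < m)) ⊆ Finset.range m := fun p hp => by
      simpa using (Finset.mem_filter.1 hp).2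
    have h4 := Finset.card_le_card h3
    rw [Finset.card_range] at h4
    exact_mod_cast h4
  have h5 := (abs_le.1 (hC n hn)).1
  rw [Real.exp_le_exp, neg_le_neg_iff]
  calc ‖s‖ ^ 2 / 16 * Real.log (Real.log n) = ‖s‖ ^ 2 / 8 * (Real.log (Real.log n) / 2) := by ring
    _ ≤ _ := by gcongr; linarith

lemma log_log_pos {n : ℕ} (hn : 3 ≤ n) : 0 < Real.log (Real.log n) := by
  refine Real.log_pos ?_
  rw [Real.lt_log_iff_exp_lt (by positivity)]
  have : (3 : ℝ) ≤ n := by exact_mod_cast hn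
  linarith [Real.exp_one_lt_d9]

lemma zetaScale_sq {n : ℕ} (hn : 3 ≤ n) : zetaScale n ^ 2 = Real.log (Real.log n) / 2 :=
  Real.sq_sqrt (by linarith [log_log_pos hn])

lemma zetaScale_pos {n : ℕ} (hn : 3 ≤ n) : 0 < zetaScale n :=
  Real.sqrt_pos.2 (by linarith [log_log_pos hn])

lemma tendsto_zetaScale_atTop : Tendsto zetaScale atTop atTop :=
  Real.tendsto_sqrt_atTop.comp (tendsto_log_log_natCast_atTop.atTop_div_const two_pos)

/-- After rescaling, the characteristic functions have a Gaussian bound on the growing balls of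
radius `k * zetaScale n`. -/
lemma eventually_norm_charFun_scaled_le (hY_meas : ∀ p, Measurable (Y p))
    (hY_indep : iIndepFun Y P) (hY_unif : ∀ p, P.map (Y p) = uniformUnitCircle) (k : ℝ) :
    ∀ᶠ n : ℕ in atTop, ∀ u : ℂ, ‖(zetaScale n)⁻¹ • u‖ ≤ k →
      ‖charFun (P.map (zetaModel Y n)) ((zetaScale n)⁻¹ • u)‖
        ≤ Real.exp (-(1 / 8 * ‖u‖ ^ 2)) := by
  filter_upwards [eventually_norm_charFun_zetaModel_le hY_meas hY_indep hY_unif k,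
    eventually_ge_atTop 3] with n hn h3 u hu
  refine (hn _ hu).trans (le_of_eq ?_)
  have hpos := zetaScale_pos h3
  have hsq := zetaScale_sq h3
  rw [norm_smul, norm_inv, Real.norm_of_nonneg hpos.le, mul_pow, inv_pow, hsq]
  have := log_log_pos h3
  congr 2
  field_simp
  ring

/-- Convergence of the rescaled characteristic functions, with a rate uniform on balls. -/
lemma tendstoUniformlyOn_charFun_scaled (hY_meas : ∀ p, Measurable (Y p))
    (hY_indep : iIndepFun Y P) (hY_unif : ∀ p, P.map (Y p) = uniformUnitCircle) (R : ℝ) :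
    TendstoUniformlyOn
      (fun (n : ℕ) (u : ℂ) => charFun (P.map (zetaModel Y n)) ((zetaScale n)⁻¹ • u))
      (charFun (stdGaussian ℂ)) atTop (Metric.closedBall 0 R) := by
  obtain ⟨C, hC0, hC⟩ := exists_abs_sum_primesLE_one_div_sub_log_log_le
  obtain ⟨D, hD0, hD⟩ := exists_norm_charFun_zetaModel_sub_exp_le hY_meas hY_indep hY_unif
  set q : ℕ → ℝ := fun n => (zetaScale n)⁻¹ * R with hq
  have hq0 : Tendsto q atTop (𝓝 0) := by
    simpa using (tendsto_inv_atTop_zero.comp tendsto_zetaScale_atTop).mul_const R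
  set B : ℕ → ℝ := fun n =>
    (112 * q n ^ 2 * (1 + q n) + q n ^ 4) * D + R ^ 2 / 2 * (C / Real.log (Real.log n)) with hB
  have hB0 : Tendsto B atTop (𝓝 0) := by
    have h1 : Tendsto (fun n => (112 * q n ^ 2 * (1 + q n) + q n ^ 4) * D) atTop (𝓝 0) := by
      have := ((((hq0.pow 2).const_mul 112).mul (hq0.const_add 1)).add (hq0.pow 4)).mul_const D
      simpa using this
    have h2 := (tendsto_log_log_natCast_atTop.const_div_atTop C).const_mul (R ^ 2 / 2)
    simpa using h1.add h2
  rw [Metric.tendstoUniformlyOn_iff]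
  intro ε hε
  filter_upwards [hB0.eventually (gt_mem_nhds hε), eventually_ge_atTop 3] with n hn h3 u hu
  rw [mem_closedBall_zero_iff] at hu
  have hR : 0 ≤ R := (norm_nonneg u).trans hu
  have hpos := zetaScale_pos h3
  have hll := log_log_pos h3
  have hsu : ‖(zetaScale n)⁻¹ • u‖ = (zetaScale n)⁻¹ * ‖u‖ := by
    rw [norm_smul, norm_inv, Real.norm_of_nonneg hpos.le]
  have hsq : ‖(zetaScale n)⁻¹ • u‖ ≤ q n := by rw [hsu]; simp only [hq]; gcongr
  have hb1 := hD n ((zetaScale n)⁻¹ • u)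
  set S := ∑ p ∈ n.primesLE, 1 / (p : ℝ) with hS
  have hS0 : 0 ≤ S := Finset.sum_nonneg fun _ _ => by positivity
  have hb2 : ‖((Real.exp (-(‖(zetaScale n)⁻¹ • u‖ ^ 2 / 4 * S)) : ℝ) : ℂ)
      - charFun (stdGaussian ℂ) u‖ ≤ R ^ 2 / 2 * (C / Real.log (Real.log n)) := by
    have e : charFun (stdGaussian ℂ) u = ((Real.exp (-(‖u‖ ^ 2 / 2)) : ℝ) : ℂ) := by
      rw [charFun_stdGaussian]; push_cast; ring_nf
    rw [e, ← Complex.ofReal_sub, Complex.norm_real, Real.norm_eq_abs]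
    refine (abs_exp_neg_sub_exp_neg_le (by positivity) (by positivity)).trans ?_
    have e2 : ‖(zetaScale n)⁻¹ • u‖ ^ 2 / 4 * S - ‖u‖ ^ 2 / 2
        = ‖u‖ ^ 2 / 2 * ((S - Real.log (Real.log n)) / Real.log (Real.log n)) := by
      rw [hsu, mul_pow, inv_pow, zetaScale_sq h3]
      field_simp
      ring
    rw [e2, abs_mul, abs_of_nonneg (by positivity : 0 ≤ ‖u‖ ^ 2 / 2), abs_div, abs_of_pos hll]
    have := hC n (by omega)
    gcongr
  rw [dist_comm, dist_eq_norm]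
  calc _ ≤ _ + _ := norm_sub_le_norm_sub_add_norm_sub _ _ _
    _ ≤ (112 * ‖(zetaScale n)⁻¹ • u‖ ^ 2 * (1 + ‖(zetaScale n)⁻¹ • u‖)
          + ‖(zetaScale n)⁻¹ • u‖ ^ 4) * D + R ^ 2 / 2 * (C / Real.log (Real.log n)) :=
        add_le_add hb1 hb2
    _ ≤ B n := by simp only [hB]; gcongr
    _ < ε := hn

end

/-! ### Mod-Gaussian convergence -/

lemma integrable_exp_neg_mul_sq_norm {b : ℝ} (hb : 0 < b) :
    Integrable (fun u : ℂ => Real.exp (-(b * ‖u‖ ^ 2))) := by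
  have h := (GaussianFourier.integrable_cexp_neg_mul_sq_norm_add (V := ℂ) (b := (b : ℂ))
    (by simpa using hb) 0 0).norm
  refine h.congr (ae_of_all _ fun u => ?_)
  simp only [zero_mul, add_zero, Complex.norm_exp]
  rw [show -(b : ℂ) * (‖u‖ : ℂ) ^ 2 = ((-(b * ‖u‖ ^ 2) : ℝ) : ℂ) by push_cast; ring,
    Complex.ofReal_re]

lemma charFun_stdGaussian_eq_ofReal (u : ℂ) :
    charFun (stdGaussian ℂ) u = ((Real.exp (-(1 / 2 * ‖u‖ ^ 2)) : ℝ) : ℂ) := by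
  rw [charFun_stdGaussian]; push_cast; ring_nf

lemma integrable_charFun_stdGaussian : Integrable (charFun (stdGaussian ℂ)) :=
  (integrable_exp_neg_mul_sq_norm one_half_pos).ofReal.congr
    (ae_of_all _ fun u => (charFun_stdGaussian_eq_ofReal u).symm)

/-- The tails `∫_{a ≤ |u|} |g|` of an integrable function tend to zero. -/
lemma tendsto_setLIntegral_le_norm_atTop {g : ℂ → ℝ} (hg : Integrable g) :
    Tendsto (fun a : ℝ => ∫⁻ u in {u : ℂ | a ≤ ‖u‖}, ‖g u‖ₑ) atTop (𝓝 0) := by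
  have hmeas : ∀ a : ℝ, MeasurableSet {u : ℂ | a ≤ ‖u‖} := fun a =>
    measurableSet_le measurable_const measurable_norm
  simp_rw [← lintegral_indicator (hmeas _)]
  have h0 : ∫⁻ _ : ℂ, (0 : ℝ≥0∞) = 0 := lintegral_zero
  rw [← h0]
  refine tendsto_lintegral_filter_of_dominated_convergence' (fun u => ‖g u‖ₑ)
    (Eventually.of_forall fun a => hg.aestronglyMeasurable.enorm.indicator (hmeas a))
    (Eventually.of_forall fun a => ae_of_all _ fun u => Set.indicator_le_self _ _ u)
    hg.hasFiniteIntegral.ne (ae_of_all _ fun u => ?_)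
  refine tendsto_const_nhds.congr' ?_
  filter_upwards [eventually_gt_atTop ‖u‖] with a ha
  rw [Set.indicator_of_notMem]
  simpa using ha

lemma adjoint_smul_id_apply (c : ℝ) (u : ℂ) :
    ContinuousLinearMap.adjoint (c • ContinuousLinearMap.id ℝ ℂ) u = c • u := by
  have h : ContinuousLinearMap.adjoint (c • ContinuousLinearMap.id ℝ ℂ)
      = c • ContinuousLinearMap.id ℝ ℂ := by
    rw [map_smulₛₗ, ContinuousLinearMap.adjoint_id]; rfl
  rw [h]; rfl

lemma measurable_zetaModel {Ω : Type*} [MeasurableSpace Ω] {Y : Nat.Primes → Ω → ℂ}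
    (hY_meas : ∀ p, Measurable (Y p)) (n : ℕ) : Measurable (zetaModel Y n) := by
  unfold zetaModel
  refine (Finset.measurable_sum _ fun p _ => ?_).neg
  exact Complex.measurable_log.comp (((hY_meas p).div_const _).const_sub 1)

lemma modPhiConvergence_zetaModel {Ω : Type*} [MeasurableSpace Ω] {P : Measure Ω}
    [IsProbabilityMeasure P] {Y : Nat.Primes → Ω → ℂ} (hY_meas : ∀ p, Measurable (Y p))
    (hY_indep : iIndepFun Y P) (hY_unif : ∀ p, P.map (Y p) = uniformUnitCircle) :
    ModPhiConvergence P (stdGaussian ℂ)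
      (fun n => zetaModel Y (n + 3))
      (fun n => zetaScale (n + 3) • ContinuousLinearMap.id ℝ ℂ)
      (fun n => (zetaScale (n + 3))⁻¹ • ContinuousLinearMap.id ℝ ℂ) where
  aemeasurable n := (measurable_zetaModel hY_meas _).aemeasurable
  left_inv n := by
    have := (zetaScale_pos (n := n + 3) (by omega)).ne'
    ext; simp [this]
  right_inv n := by
    have := (zetaScale_pos (n := n + 3) (by omega)).ne'
    ext; simp [this]
  integrable_charFun := integrable_charFun_stdGaussian
  tendsto_zero := by
    have h : Tendsto (fun n => (zetaScale (n + 3))⁻¹) atTop (𝓝 0) :=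
      (tendsto_inv_atTop_zero.comp tendsto_zetaScale_atTop).comp (tendsto_add_atTop_nat 3)
    have h0 : (0 : ℝ) • ContinuousLinearMap.id ℝ ℂ = 0 := by ext; simp
    rw [← h0]
    exact h.smul_const (ContinuousLinearMap.id ℝ ℂ)
  tendsto_charFun K hK := by
    obtain ⟨R, hR⟩ := hK.isBounded.subset_closedBall 0
    simp only [adjoint_smul_id_apply]
    intro V hV
    exact (tendsto_add_atTop_nat 3).eventually
      (((tendstoUniformlyOn_charFun_scaled hY_meas hY_indep hY_unif R).mono hR) V hV)
  uniformly_integrable k hk := by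
    simp only [adjoint_smul_id_apply]
    obtain ⟨N, hN⟩ := eventually_atTop.1
      (eventually_norm_charFun_scaled_le hY_meas hY_indep hY_unif k)
    -- For small indices the domain of integration is empty as soon as `a` is large.
    obtain ⟨M, hM⟩ : ∃ M : ℝ, ∀ n < N, k * zetaScale n ≤ M := by
      obtain ⟨M, hM⟩ := ((Finset.range N).image fun n => k * zetaScale n).bddAbove
      exact ⟨M, fun n hn => hM (by
        simp only [Finset.coe_image, Set.mem_image, Finset.coe_range, Set.mem_Iio]
        exact ⟨n, hn, rfl⟩)⟩
    refine tendsto_of_tendsto_of_tendsto_of_le_of_le' tendsto_const_nhds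
      (tendsto_setLIntegral_le_norm_atTop (integrable_exp_neg_mul_sq_norm
        (show (0 : ℝ) < 1 / 8 by norm_num))) (Eventually.of_forall fun _ => zero_le) ?_
    filter_upwards [eventually_gt_atTop M] with a ha
    refine iSup_le fun n => ?_
    have hpos := zetaScale_pos (n := n + 3) (by omega)
    have hmeas : MeasurableSet {t : ℂ | a ≤ ‖t‖ ∧ ‖(zetaScale (n + 3))⁻¹ • t‖ ≤ k} :=
      (measurableSet_le measurable_const measurable_norm).inter
        (measurableSet_le (f := fun t : ℂ => ‖(zetaScale (n + 3))⁻¹ • t‖)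
          (measurable_const_smul _).norm measurable_const)
    rcases lt_or_ge (n + 3) N with h | h
    · have hempty : {t : ℂ | a ≤ ‖t‖ ∧ ‖(zetaScale (n + 3))⁻¹ • t‖ ≤ k} = ∅ := by
        refine Set.eq_empty_iff_forall_notMem.2 fun t ht => ?_
        obtain ⟨h1, h2⟩ := ht
        rw [norm_smul, norm_inv, Real.norm_of_nonneg hpos.le, inv_mul_le_iff₀ hpos] at h2
        have := hM _ h
        linarith
      rw [hempty]
      simp
    · refine (setLIntegral_mono' hmeas fun t ht => ?_).trans
        (lintegral_mono_set fun t ht => ht.1)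
      rw [enorm_le_iff_norm_le, Real.norm_of_nonneg (Real.exp_pos _).le]
      exact hN (n + 3) h t ht.2

/-! ### Fourier analysis on a Euclidean space -/

section ParsevalFormula

open FourierTransform Module

variable {E : Type*} [NormedAddCommGroup E] [InnerProductSpace ℝ E] [FiniteDimensional ℝ E]
  [MeasurableSpace E] [BorelSpace E]

/-- Parseval's formula for a finite measure and an integrable function. -/
lemma integral_fourier_eq_integral_mul_charFun (μ : Measure E) [IsFiniteMeasure μ] {g : E → ℂ}
    (hg : Integrable g) :
    ∫ x, 𝓕 g x ∂μ = ∫ v, g v * charFun μ ((-(2 * Real.pi)) • v) := by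
  simp_rw [Real.fourier_eq]
  rw [integral_integral_swap]
  · refine integral_congr_ae (ae_of_all _ fun v => ?_)
    simp only [Circle.smul_def, Real.fourierChar_apply, smul_eq_mul]
    rw [integral_mul_const, mul_comm, charFun_apply]
    congr 1
    refine integral_congr_ae (ae_of_all _ fun x => ?_)
    simp only [inner_smul_right, real_inner_comm v x]
    push_cast
    ring_nf
  · have h1 : Integrable (fun z : E × E => g z.2) (μ.prod volume) := by
      simpa using (integrable_const (1 : ℂ) (μ := μ)).mul_prod hg
    refine h1.mono ?_ (ae_of_all _ fun z => ?_)
    · refine AEStronglyMeasurable.smul (f := fun z : E × E => 𝐞 (-inner ℝ z.2 z.1)) ?_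
        h1.aestronglyMeasurable
      exact (Continuous.aestronglyMeasurable (by fun_prop))
    · simp [Function.uncurry, Circle.norm_smul]

/-- The rescaled Parseval integrals see only the value of the test function at the origin. -/
lemma tendsto_pow_smul_integral_mul_charFun {μ : ℕ → Measure E} [∀ n, IsProbabilityMeasure (μ n)]
    {a : ℕ → ℝ} (ha : Tendsto a atTop atTop) {φ : E → ℂ}
    (hφ : ∀ u, Tendsto (fun n => charFun (μ n) ((a n)⁻¹ • u)) atTop (𝓝 (φ u)))
    (hdom : ∀ k : ℝ, ∃ G : E → ℝ, Integrable G ∧ ∀ᶠ n in atTop, ∀ u,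
      ‖(a n)⁻¹ • u‖ ≤ k → ‖charFun (μ n) ((a n)⁻¹ • u)‖ ≤ G u)
    {g : E → ℂ} (hg : Continuous g) (hgc : HasCompactSupport g) :
    Tendsto (fun n => (a n ^ finrank ℝ E) • ∫ s, g s * charFun (μ n) s) atTop
      (𝓝 (g 0 * ∫ u, φ u)) := by
  obtain ⟨k, hk⟩ := hgc.isCompact.isBounded.subset_closedBall 0
  obtain ⟨M, hM⟩ := hg.bounded_above_of_compact_support hgc
  obtain ⟨G, hG, hGb⟩ := hdom k
  have hainv : Tendsto (fun n => (a n)⁻¹) atTop (𝓝 0) := tendsto_inv_atTop_zero.comp ha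
  have hM0 : 0 ≤ M := (norm_nonneg _).trans (hM 0)
  rw [← integral_const_mul]
  have hlim : Tendsto (fun n => ∫ u, g ((a n)⁻¹ • u) * charFun (μ n) ((a n)⁻¹ • u)) atTop
      (𝓝 (∫ u, g 0 * φ u)) := by
    refine tendsto_integral_filter_of_dominated_convergence (fun u => M * |G u|)
      (Eventually.of_forall fun n => ?_) ?_ (hG.abs.const_mul M) (ae_of_all _ fun u => ?_)
    · have := continuous_charFun (μ := μ n)
      exact Continuous.aestronglyMeasurable (by fun_prop)
    · filter_upwards [hGb] with n hn
      refine ae_of_all _ fun u => ?_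
      by_cases hu : ‖(a n)⁻¹ • u‖ ≤ k
      · rw [norm_mul]
        exact mul_le_mul (hM _) ((hn u hu).trans (le_abs_self _)) (norm_nonneg _) hM0
      · have : g ((a n)⁻¹ • u) = 0 := by
          by_contra h
          exact hu (by simpa using hk (subset_tsupport _ h))
        rw [this, zero_mul, norm_zero]
        positivity
    · refine Tendsto.mul ?_ (hφ u)
      have := (hg.tendsto 0).comp (by simpa using hainv.smul_const u :
        Tendsto (fun n => (a n)⁻¹ • u) atTop (𝓝 0))
      exact this
  refine hlim.congr' ?_
  filter_upwards [ha.eventually_ge_atTop 0] with n hn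
  rw [Measure.integral_comp_inv_smul volume (fun s => g s * charFun (μ n) s),
    abs_of_nonneg (by positivity)]

lemma tendsto_pow_smul_integral_fourier {μ : ℕ → Measure E} [∀ n, IsProbabilityMeasure (μ n)]
    {a : ℕ → ℝ} (ha : Tendsto a atTop atTop) {φ : E → ℂ}
    (hφ : ∀ u, Tendsto (fun n => charFun (μ n) ((a n)⁻¹ • u)) atTop (𝓝 (φ u)))
    (hdom : ∀ k : ℝ, ∃ G : E → ℝ, Integrable G ∧ ∀ᶠ n in atTop, ∀ u,
      ‖(a n)⁻¹ • u‖ ≤ k → ‖charFun (μ n) ((a n)⁻¹ • u)‖ ≤ G u)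
    {g : E → ℂ} (hg : Continuous g) (hgc : HasCompactSupport g) :
    Tendsto (fun n => (a n ^ finrank ℝ E) • ∫ x, 𝓕 g x ∂(μ n)) atTop
      (𝓝 (((2 * Real.pi) ^ finrank ℝ E)⁻¹ • (g 0 * ∫ u, φ u))) := by
  set R : ℝ := -(2 * Real.pi) with hR
  have hR0 : R ≠ 0 := by rw [hR]; exact neg_ne_zero.2 (by positivity)
  have hRa : |(R ^ finrank ℝ E)⁻¹| = ((2 * Real.pi) ^ finrank ℝ E)⁻¹ := by
    rw [abs_inv, abs_pow, hR, abs_neg, abs_of_pos (by positivity)]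
  have h := tendsto_pow_smul_integral_mul_charFun ha hφ hdom
    (g := fun s => g (R⁻¹ • s)) (by fun_prop) (hgc.comp_smul (inv_ne_zero hR0))
  simp only [smul_zero] at h
  refine (h.const_smul ((2 * Real.pi) ^ finrank ℝ E)⁻¹).congr fun n => ?_
  rw [integral_fourier_eq_integral_mul_charFun _ (hg.integrable_of_hasCompactSupport hgc),
    smul_comm]
  congr 1
  have := Measure.integral_comp_smul volume (fun s => g (R⁻¹ • s) * charFun (μ n) s) R
  rw [hRa] at this
  rw [← this]
  simp only [smul_smul, inv_mul_cancel₀ hR0, one_smul]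
  rfl

lemma fourier_comp_add_right (g : E → ℂ) (t x : E) :
    𝓕 (fun v => g (v + (2 * Real.pi)⁻¹ • t)) x
      = Complex.exp ((inner ℝ x t : ℝ) * Complex.I) * 𝓕 g x := by
  have h := congrFun (VectorFourier.fourierIntegral_comp_add_right 𝐞 volume (innerₗ E) g
    ((2 * Real.pi)⁻¹ • t)) x
  refine h.trans ?_
  simp only [Circle.smul_def, Real.fourierChar_apply, smul_eq_mul, innerₗ_apply_apply]
  congr 2
  rw [real_inner_smul_left, real_inner_comm]
  push_cast
  have : (Real.pi : ℂ) ≠ 0 := by exact_mod_cast Real.pi_ne_zero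
  field_simp

/-- There are band-limited, integrable, nonnegative functions that are bounded below on a given
ball: squares of the Fourier transform of a bump function with small support. -/
lemma exists_fourier_nonneg_le_on_closedBall (R : ℝ) :
    ∃ (g : E → ℂ) (h : E → ℝ) (η : ℝ), Continuous g ∧ HasCompactSupport g ∧ Continuous h ∧
      Integrable h ∧ (∀ x, 𝓕 g x = (h x : ℂ)) ∧ (∀ x, 0 ≤ h x) ∧ 0 < η ∧
      ∀ x, ‖x‖ ≤ R → η ≤ h x := by
  -- the radius is such that `2 π ⟪v, x⟫` is at most `1 / 2` for `v` in the support and `‖x‖ ≤ R`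
  set δ : ℝ := (4 * Real.pi * (|R| + 1))⁻¹ with hδ
  have hδ0 : 0 < δ := by positivity
  let b : ContDiffBump (0 : E) := ⟨δ / 2, δ, by positivity, by linarith⟩
  set w : E → ℂ := fun v => ((b v : ℝ) : ℂ) with hw
  have hwc : HasCompactSupport w :=
    b.hasCompactSupport.comp_left (g := fun r : ℝ => (r : ℂ)) Complex.ofReal_zero
  have hwd : ContDiff ℝ (↑(⊤ : ℕ∞)) w := Complex.ofRealCLM.contDiff.comp b.contDiff
  have hwcont : Continuous w := hwd.continuous
  have hwi : Integrable w := hwcont.integrable_of_hasCompactSupport hwc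
  set W : E → ℂ := 𝓕 w with hW
  let ws : SchwartzMap E ℂ := hwc.toSchwartzMap hwd
  have hWs : ⇑(𝓕 ws : SchwartzMap E ℂ) = W := by rw [SchwartzMap.fourier_coe]; rfl
  have hWcont : Continuous W := hWs ▸ (𝓕 ws : SchwartzMap E ℂ).continuous
  have hWi : Integrable W := hWs ▸ (𝓕 ws : SchwartzMap E ℂ).integrable
  have hWreal : ∀ x, ((W x).re : ℂ) = W x := by
    intro x
    rw [← Complex.conj_eq_iff_re, hW, Real.fourier_eq, ← integral_conj,
      ← integral_neg_eq_self]
    refine integral_congr_ae (ae_of_all _ fun v => ?_)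
    simp only [hw, Circle.smul_def, Real.fourierChar_apply, smul_eq_mul, map_mul, b.neg,
      Complex.conj_ofReal, inner_neg_left, ← Complex.exp_conj]
    congr 2
    simp
  set m : ℝ := ∫ v, b v with hm
  have hm0 : 0 < m := b.integral_pos
  have hWlow : ∀ x, ‖x‖ ≤ R → m / 2 ≤ (W x).re := by
    intro x hx
    have h1 : ‖W x - m‖ ≤ m / 2 := by
      have e : W x - m = ∫ v, ((𝐞 (-inner ℝ v x) : ℂ) - 1) * w v := by
        have hi : Integrable (fun v => (𝐞 (-inner ℝ v x) : ℂ) * w v) := by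
          refine hwi.bdd_mul (c := 1) ?_ (ae_of_all _ fun v => (Circle.norm_coe _).le)
          exact Continuous.aestronglyMeasurable (by fun_prop)
        simp_rw [sub_mul, one_mul]
        rw [integral_sub hi hwi, hW, Real.fourier_eq, hm, ← integral_complex_ofReal]
        rfl
      rw [e]
      have hbi : Integrable (fun v => b v) :=
        b.continuous.integrable_of_hasCompactSupport b.hasCompactSupport
      refine (norm_integral_le_of_norm_le (g := fun v => 1 / 2 * b v) (hbi.const_mul _)
        (ae_of_all _ fun v => ?_)).trans (le_of_eq ?_)
      · rw [norm_mul, hw, Complex.norm_real, Real.norm_of_nonneg b.nonneg]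
        by_cases hv : ‖v‖ ≤ δ
        · refine mul_le_mul_of_nonneg_right ?_ b.nonneg
          rw [Real.fourierChar_apply, mul_comm]
          refine (Real.norm_exp_I_mul_ofReal_sub_one_le).trans ?_
          have h2 : |inner ℝ v x| ≤ δ * |R| :=
            (abs_real_inner_le_norm _ _).trans (by gcongr; exact hx.trans (le_abs_self R))
          rw [Real.norm_eq_abs, abs_mul, abs_neg, abs_of_pos (by positivity : 0 < 2 * Real.pi)]
          calc 2 * Real.pi * |inner ℝ v x| ≤ 2 * Real.pi * (δ * (|R| + 1)) := by
                gcongr; exact h2.trans (by gcongr; linarith)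
            _ = 1 / 2 := by rw [hδ]; field_simp; norm_num
        · have : b v = 0 := b.zero_of_le_dist (by simpa using (not_le.1 hv).le)
          simp [this]
      · rw [integral_const_mul, ← hm]; ring
    have h3 := (Complex.abs_re_le_norm _).trans h1
    rw [Complex.sub_re, Complex.ofReal_re] at h3
    linarith [(abs_le.1 h3).1]
  refine ⟨convolution w w (ContinuousLinearMap.mul ℂ ℂ) volume, fun x => (W x).re ^ 2,
    (m / 2) ^ 2, hwc.continuous_convolution_left _ hwcont hwi.locallyIntegrable,
    hwc.convolution _ hwc, by fun_prop, ?_, fun x => ?_, fun x => sq_nonneg _, by positivity,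
    fun x hx => ?_⟩
  · have h1 : Integrable (fun x => (W x).re * (W x).re) := by
      refine hWi.re.bdd_mul (c := ∫ v, ‖w v‖) ?_ (ae_of_all _ fun x => ?_)
      · exact Continuous.aestronglyMeasurable (by fun_prop)
      · exact (Complex.abs_re_le_norm _).trans
          (VectorFourier.norm_fourierIntegral_le_integral_norm _ _ _ _ _)
    simpa [sq] using h1
  · rw [Real.fourier_mul_convolution_eq hwi hwi]
    push_cast
    rw [hWreal, sq]
  · exact pow_le_pow_left₀ (by positivity) (hWlow x hx) 2

end ParsevalFormula

/-! ### The local limit theorem -/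

/-- The measure with density `h / ∫ h ∂μ` with respect to `μ`. -/
noncomputable def normalizedDensity {α : Type*} [MeasurableSpace α] (μ : Measure α)
    (h : α → ℝ) : Measure α :=
  μ.withDensity fun x => ENNReal.ofReal (h x / ∫ y, h y ∂μ)

lemma isProbabilityMeasure_normalizedDensity {α : Type*} [MeasurableSpace α]
    {μ : Measure α} {h : α → ℝ} (hi : Integrable h μ)
    (h0 : ∀ x, 0 ≤ h x) (hpos : 0 < ∫ y, h y ∂μ) :
    IsProbabilityMeasure (normalizedDensity μ h) := by
  constructor
  rw [normalizedDensity, withDensity_apply _ MeasurableSet.univ, Measure.restrict_univ,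
    ← ofReal_integral_eq_lintegral_ofReal (hi.div_const _)
      (ae_of_all _ fun x => div_nonneg (h0 x) hpos.le), integral_div, div_self hpos.ne',
    ENNReal.ofReal_one]

lemma integral_normalizedDensity {α F : Type*} [NormedAddCommGroup F] [NormedSpace ℝ F]
    [MeasurableSpace α] {μ : Measure α} {h : α → ℝ} (hc : Measurable h)
    (h0 : ∀ x, 0 ≤ h x) (hpos : 0 < ∫ y, h y ∂μ) (f : α → F) :
    ∫ x, f x ∂(normalizedDensity μ h) = (∫ y, h y ∂μ)⁻¹ • ∫ x, h x • f x ∂μ := by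
  rw [normalizedDensity, integral_withDensity_eq_integral_toReal_smul
    (by fun_prop) (ae_of_all _ fun x => ENNReal.ofReal_lt_top), ← integral_smul]
  refine integral_congr_ae (ae_of_all _ fun x => ?_)
  simp only
  rw [ENNReal.toReal_ofReal (div_nonneg (h0 x) hpos.le), smul_smul, div_eq_inv_mul]

section LocalLimit

open FourierTransform Module

variable {E : Type*} [NormedAddCommGroup E] [InnerProductSpace ℝ E] [FiniteDimensional ℝ E]
  [MeasurableSpace E] [BorelSpace E]

/-- Rescaled vague convergence to a multiple of Lebesgue measure. The measures are weighted by a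
positive band-limited density; the weighted measures converge weakly by Lévy's theorem. -/
lemma tendsto_pow_mul_integral_of_hasCompactSupport {μ : ℕ → Measure E}
    [∀ n, IsProbabilityMeasure (μ n)] {a : ℕ → ℝ} (ha : Tendsto a atTop atTop) {φ : E → ℂ}
    (hφ : ∀ u, Tendsto (fun n => charFun (μ n) ((a n)⁻¹ • u)) atTop (𝓝 (φ u)))
    (hdom : ∀ k : ℝ, ∃ G : E → ℝ, Integrable G ∧ ∀ᶠ n in atTop, ∀ u,
      ‖(a n)⁻¹ • u‖ ≤ k → ‖charFun (μ n) ((a n)⁻¹ • u)‖ ≤ G u)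
    {c : ℝ} (hc0 : 0 < c) (hc : ((2 * Real.pi) ^ finrank ℝ E)⁻¹ • ∫ u, φ u = c)
    {f : E → ℝ} (hf : Continuous f) (hfc : HasCompactSupport f) :
    Tendsto (fun n => a n ^ finrank ℝ E * ∫ x, f x ∂(μ n)) atTop (𝓝 (c * ∫ x, f x)) := by
  obtain ⟨R, hR0, hR⟩ : ∃ R, 0 ≤ R ∧ tsupport f ⊆ Metric.closedBall 0 R := by
    obtain ⟨R, hR⟩ := hfc.isCompact.isBounded.subset_closedBall 0
    exact ⟨|R|, abs_nonneg R, hR.trans (Metric.closedBall_subset_closedBall (le_abs_self R))⟩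
  obtain ⟨g, h, η, hg, hgc, hh, hhi, hgh, hh0, hη, hηh⟩ :=
    exists_fourier_nonneg_le_on_closedBall (E := E) R
  have hbdd : ∀ x, h x ≤ ∫ v, ‖g v‖ := fun x => by
    have h1 : ‖𝓕 g x‖ ≤ ∫ v, ‖g v‖ :=
      VectorFourier.norm_fourierIntegral_le_integral_norm _ _ _ _ _
    rw [hgh, Complex.norm_real] at h1
    exact (le_abs_self _).trans h1
  have hhn : ∀ n, Integrable h (μ n) := fun n =>
    Integrable.of_bound hh.aestronglyMeasurable (∫ v, ‖g v‖)
      (ae_of_all _ fun x => by rw [Real.norm_of_nonneg (hh0 x)]; exact hbdd x)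
  set ip : E → E → ℂ := fun t x => Complex.exp ((inner ℝ x t : ℝ) * Complex.I) with hip
  -- convergence of the weighted exponential integrals
  have hexp : ∀ t : E, Tendsto (fun n => (a n ^ finrank ℝ E) • ∫ x, h x • ip t x ∂(μ n)) atTop
      (𝓝 (c • ∫ x, h x • ip t x)) := by
    intro t
    set gt : E → ℂ := fun v => g (v + (2 * Real.pi)⁻¹ • t) with hgt
    have hgtF : ∀ x, 𝓕 gt x = h x • ip t x := fun x => by
      rw [hgt, fourier_comp_add_right, hgh, hip, Complex.real_smul, mul_comm]
    have hgtc : Continuous gt := by fun_prop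
    have hgts : HasCompactSupport gt := hgc.comp_homeomorph (Homeomorph.addRight _)
    have hgti : Integrable gt := hgtc.integrable_of_hasCompactSupport hgts
    have hFi : Integrable (𝓕 gt) := by
      refine hhi.mono (Continuous.aestronglyMeasurable (by rw [funext hgtF]; fun_prop))
        (ae_of_all _ fun x => ?_)
      rw [hgtF, norm_smul, hip, Complex.norm_exp_ofReal_mul_I, mul_one]
    have hinv : ∫ x, h x • ip t x = gt 0 := by
      rw [← hgtc.fourierInv_fourier_eq hgti hFi, Real.fourierInv_eq]
      simp [hgtF]
    have key := tendsto_pow_smul_integral_fourier ha hφ hdom hgtc hgts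
    simp only [hgtF] at key
    rw [← mul_smul_comm, hc, mul_comm, ← Complex.real_smul] at key
    rwa [hinv]
  have hmass : Tendsto (fun n => a n ^ finrank ℝ E * ∫ x, h x ∂(μ n)) atTop
      (𝓝 (c * ∫ x, h x)) := by
    have h1 := hexp 0
    simp only [hip, inner_zero_right, Complex.ofReal_zero, zero_mul, Complex.exp_zero,
      Complex.real_smul, mul_one, integral_complex_ofReal, ← Complex.ofReal_mul] at h1
    exact ((Complex.continuous_re.tendsto _).comp h1).congr fun n => Complex.ofReal_re _
  have hH : 0 < ∫ x, h x := by
    rw [integral_pos_iff_support_of_nonneg hh0 hhi]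
    refine hh.isOpen_support.measure_pos volume ?_
    exact ⟨0, (hη.trans_le (hηh 0 (by simpa using hR0))).ne'⟩
  have hcH : 0 < c * ∫ x, h x := mul_pos hc0 hH
  -- the masses `∫ h ∂(μ n)` may vanish for small `n`, where the normalisation is meaningless
  obtain ⟨N, hN⟩ := eventually_atTop.1
    ((hmass.eventually (lt_mem_nhds hcH)).and (ha.eventually_gt_atTop 0))
  have hmpos : ∀ n, 0 < ∫ x, h x ∂(μ (n + N)) := fun n =>
    pos_of_mul_pos_right (hN (n + N) (by omega)).1
      (pow_nonneg (hN (n + N) (by omega)).2.le _)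
  have happos : ∀ n, 0 < a (n + N) ^ finrank ℝ E := fun n =>
    pow_pos (hN (n + N) (by omega)).2 _
  let ν : ℕ → ProbabilityMeasure E := fun n => ⟨normalizedDensity (μ (n + N)) h,
    isProbabilityMeasure_normalizedDensity (hhn _) hh0 (hmpos n)⟩
  let ν₀ : ProbabilityMeasure E := ⟨normalizedDensity volume h,
    isProbabilityMeasure_normalizedDensity hhi hh0 hH⟩
  have hmassN := hmass.comp (tendsto_add_atTop_nat N)
  have hνlim : Tendsto ν atTop (𝓝 ν₀) := by
    refine ProbabilityMeasure.tendsto_iff_tendsto_charFun.2 fun t => ?_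
    have h1 := (hmassN.inv₀ hcH.ne').smul ((hexp t).comp (tendsto_add_atTop_nat N))
    simp only [ν, ν₀, ProbabilityMeasure.coe_mk, charFun_apply]
    rw [integral_normalizedDensity hh.measurable hh0 hH]
    refine (h1.congr fun n => ?_).trans (le_of_eq ?_)
    · rw [integral_normalizedDensity hh.measurable hh0 (hmpos n)]
      simp only [Function.comp_apply, smul_smul]
      congr 1
      rw [mul_inv, mul_right_comm, inv_mul_cancel₀ (happos n).ne', one_mul]
    · rw [smul_smul, mul_inv, mul_right_comm, inv_mul_cancel₀ hc0.ne', one_mul]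
  -- the quotient `f / h`, with the denominator truncated where `f` vanishes
  obtain ⟨M, hM⟩ := hf.bounded_above_of_compact_support hfc
  have hmax : ∀ x, 0 < max (h x) η := fun x => lt_max_of_lt_right hη
  have hqc : Continuous fun x => f x / max (h x) η :=
    hf.div (hh.max continuous_const) fun x => (hmax x).ne'
  let q : BoundedContinuousFunction E ℝ :=
    BoundedContinuousFunction.ofNormedAddCommGroup _ hqc (M / η) fun x => by
      rw [norm_div, Real.norm_of_nonneg (hmax x).le]
      exact div_le_div₀ ((norm_nonneg _).trans (hM x)) (hM x) hη (le_max_right _ _)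
  have hq : ∀ x, h x • q x = f x := by
    intro x
    change h x * (f x / max (h x) η) = f x
    by_cases hx : ‖x‖ ≤ R
    · rw [max_eq_left (hηh x hx)]
      have := (hη.trans_le (hηh x hx)).ne'
      field_simp
    · have : f x = 0 := by
        by_contra h'
        exact hx (by simpa using hR (subset_tsupport _ h'))
      rw [this]; simp
  have hlim := ProbabilityMeasure.tendsto_iff_forall_integral_tendsto.1 hνlim q
  simp only [ν, ν₀, ProbabilityMeasure.coe_mk] at hlim
  rw [integral_normalizedDensity hh.measurable hh0 hH] at hlim
  simp only [hq] at hlim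
  rw [← tendsto_add_atTop_iff_nat N]
  refine ((hmassN.mul hlim).congr fun n => ?_).trans (le_of_eq ?_)
  · rw [integral_normalizedDensity hh.measurable hh0 (hmpos n)]
    simp only [hq, Function.comp_apply, smul_eq_mul]
    rw [mul_assoc, mul_inv_cancel_left₀ (hmpos n).ne']
  · rw [smul_eq_mul, mul_assoc, mul_inv_cancel_left₀ hH.ne']

/-- Sandwich argument: rescaled vague convergence to a multiple of Lebesgue measure gives
convergence on bounded sets with negligible boundary. Such a set need not be Borel; it is squeezed
between its interior and its closure. -/
lemma tendsto_mul_measureReal_of_frontier {Ω : Type*} [MeasurableSpace Ω] {P : Measure Ω}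
    [IsProbabilityMeasure P] {X : ℕ → Ω → E} (hX : ∀ n, Measurable (X n)) {A : ℕ → ℝ}
    (hA : ∀ᶠ n in atTop, 0 ≤ A n) {c : ℝ}
    (hvague : ∀ f : E → ℝ, Continuous f → HasCompactSupport f →
      Tendsto (fun n => A n * ∫ x, f x ∂(P.map (X n))) atTop (𝓝 (c * ∫ x, f x)))
    (hc0 : 0 < c) {B : Set E} (hB : Bornology.IsBounded B) (hfr : volume (frontier B) = 0) :
    Tendsto (fun n => A n * P.real {ω | X n ω ∈ B}) atTop
      (𝓝 (c * (volume : Measure E).real B)) := by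
  have hprob : ∀ n, IsProbabilityMeasure (P.map (X n)) := fun n =>
    Measure.isProbabilityMeasure_map (hX n).aemeasurable
  have hcomp : IsCompact (closure B) := hB.isCompact_closure
  have hcl_le : volume (closure B) ≤ volume (interior B) := by
    rw [closure_eq_interior_union_frontier]
    exact (measure_union_le _ _).trans (by rw [hfr, add_zero])
  have hint : volume (interior B) = volume B :=
    le_antisymm (measure_mono interior_subset) ((measure_mono subset_closure).trans hcl_le)
  have hcl : volume (closure B) = volume B :=
    le_antisymm (hcl_le.trans hint.le) (measure_mono subset_closure)
  have hBfin : volume B ≠ ∞ := hcl ▸ hcomp.measure_lt_top.ne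
  refine tendsto_order.2 ⟨fun l hl => ?_, fun r hr => ?_⟩
  · rcases lt_or_ge l 0 with hl0 | hl0
    · filter_upwards [hA] with n hn
      exact hl0.trans_le (by positivity)
    obtain ⟨f, hf, hfU, hf0, hf1, hlf⟩ : ∃ f : E → ℝ, Continuous f ∧
        Set.EqOn f 0 (interior B)ᶜ ∧ 0 ≤ f ∧ f ≤ 1 ∧ l < c * ∫ x, f x := by
      have : IsFiniteMeasure ((volume : Measure E).restrict (interior B)) :=
        ⟨by rw [Measure.restrict_apply_univ, hint]; exact hBfin.lt_top⟩
      have h1 := isOpen_interior.measure_eq_biSup_integral_continuous (U := interior B)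
        ((volume : Measure E).restrict (interior B))
      rw [Measure.restrict_apply_self, hint] at h1
      have h2 : ENNReal.ofReal (l / c) < volume B := by
        rw [ENNReal.ofReal_lt_iff_lt_toReal (by positivity) hBfin, div_lt_iff₀' hc0]
        exact hl
      rw [h1] at h2
      simp only [lt_iSup_iff, exists_prop] at h2
      obtain ⟨f, hf, hfU, hf0, hf1, h3⟩ := h2
      refine ⟨f, hf, hfU, hf0, hf1, ?_⟩
      rw [ENNReal.ofReal_lt_ofReal_iff_of_nonneg (by positivity), div_lt_iff₀' hc0,
        setIntegral_eq_integral_of_forall_compl_eq_zero fun x hx => hfU hx] at h3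
      exact h3
    have hfc : HasCompactSupport f := HasCompactSupport.intro hcomp fun x hx =>
      hfU fun h => hx (subset_closure (interior_subset h))
    filter_upwards [(hvague f hf hfc).eventually (lt_mem_nhds hlf), hA] with n hn hAn
    refine hn.trans_le (mul_le_mul_of_nonneg_left ?_ hAn)
    have h4 := integral_le_measure (μ := P.map (X n)) (f := f) (s := interior B)
      (fun x _ => hf1 x) (fun x hx => (hfU hx).le)
    rw [Measure.map_apply (hX n) isOpen_interior.measurableSet] at h4
    rw [measureReal_def, ← ENNReal.ofReal_le_iff_le_toReal (measure_ne_top _ _)]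
    exact h4.trans (measure_mono fun ω hω => show X n ω ∈ B from interior_subset hω)
  · obtain ⟨f, hf, hfc, hfK, hf0, hfr'⟩ : ∃ f : E → ℝ, Continuous f ∧ HasCompactSupport f ∧
        Set.EqOn f 1 (closure B) ∧ 0 ≤ f ∧ c * ∫ x, f x < r := by
      have h1 := hcomp.measure_eq_biInf_integral_hasCompactSupport (volume : Measure E)
      have h2 : volume B < ENNReal.ofReal (r / c) := by
        rw [ENNReal.lt_ofReal_iff_toReal_lt hBfin, lt_div_iff₀' hc0]
        exact hr
      rw [← hcl, h1] at h2
      simp only [iInf_lt_iff, exists_prop] at h2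
      obtain ⟨f, hf, hfc, hfK, hf0, h3⟩ := h2
      refine ⟨f, hf, hfc, hfK, hf0, ?_⟩
      rwa [ENNReal.ofReal_lt_ofReal_iff_of_nonneg (integral_nonneg hf0), lt_div_iff₀' hc0] at h3
    filter_upwards [(hvague f hf hfc).eventually (gt_mem_nhds hfr'), hA] with n hn hAn
    refine (mul_le_mul_of_nonneg_left ?_ hAn).trans_lt hn
    have h4 := (hf.integrable_of_hasCompactSupport hfc (μ := P.map (X n))).measure_le_integral
      (s := closure B) (Eventually.of_forall hf0) (fun x hx => by simp [hfK hx])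
    rw [Measure.map_apply (hX n) isClosed_closure.measurableSet] at h4
    refine ENNReal.toReal_le_of_le_ofReal (integral_nonneg hf0) ((measure_mono ?_).trans h4)
    exact fun ω hω => subset_closure hω

end LocalLimit

theorem mainTheorem12 {Ω : Type*} [MeasurableSpace Ω] (P : Measure Ω) [IsProbabilityMeasure P]
    (Y : Nat.Primes → Ω → ℂ) (hY_meas : ∀ p, Measurable (Y p)) (hY_indep : iIndepFun Y P)
    (hY_unif : ∀ p, P.map (Y p) = uniformUnitCircle) :
    ModPhiConvergence P (stdGaussian ℂ)
      (fun n => zetaModel Y (n + 3))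
      (fun n => zetaScale (n + 3) • ContinuousLinearMap.id ℝ ℂ)
      (fun n => (zetaScale (n + 3))⁻¹ • ContinuousLinearMap.id ℝ ℂ) ∧
    ∀ B : Set ℂ, IsBoundedJordanMeasurable B →
      Tendsto
        (fun n : ℕ => Real.log (Real.log (n : ℝ)) / 2 * P.real {ω | zetaModel Y n ω ∈ B})
        atTop (𝓝 ((volume : Measure ℂ).real B / (2 * Real.pi))) := by
  refine ⟨modPhiConvergence_zetaModel hY_meas hY_indep hY_unif, fun B hB => ?_⟩
  have hmeas := measurable_zetaModel hY_meas
  have hprob : ∀ n, IsProbabilityMeasure (P.map (zetaModel Y n)) := fun n =>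
    Measure.isProbabilityMeasure_map (hmeas n).aemeasurable
  have hc : ((2 * Real.pi) ^ Module.finrank ℝ ℂ)⁻¹ • ∫ u, charFun (stdGaussian ℂ) u
      = ((1 / (2 * Real.pi) : ℝ) : ℂ) := by
    have h1 := GaussianFourier.integral_cexp_neg_mul_sq_norm (V := ℂ) (b := 1 / 2) (by norm_num)
    have h2 : ∫ u : ℂ, charFun (stdGaussian ℂ) u = 2 * Real.pi := by
      calc _ = ∫ u : ℂ, Complex.exp (-(1 / 2) * (‖u‖ : ℂ) ^ 2) := by
            refine integral_congr_ae (ae_of_all _ fun u => ?_)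
            simp only [charFun_stdGaussian]; ring_nf
        _ = _ := by
            rw [h1, Complex.finrank_real_complex]
            norm_num
            ring
    rw [h2, Complex.finrank_real_complex, Complex.real_smul]
    push_cast
    have : (Real.pi : ℂ) ≠ 0 := by exact_mod_cast Real.pi_ne_zero
    field_simp
  have hvague : ∀ f : ℂ → ℝ, Continuous f → HasCompactSupport f →
      Tendsto (fun n : ℕ => Real.log (Real.log (n : ℝ)) / 2 * ∫ x, f x ∂(P.map (zetaModel Y n)))
        atTop (𝓝 (1 / (2 * Real.pi) * ∫ x, f x)) := by
    intro f hf hfc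
    have h := tendsto_pow_mul_integral_of_hasCompactSupport tendsto_zetaScale_atTop
      (fun u => (tendstoUniformlyOn_charFun_scaled hY_meas hY_indep hY_unif ‖u‖).tendsto_at
        (by simp))
      (fun k => ⟨_, integrable_exp_neg_mul_sq_norm (by norm_num),
        eventually_norm_charFun_scaled_le hY_meas hY_indep hY_unif k⟩)
      (by positivity) hc hf hfc
    refine h.congr' ?_
    filter_upwards [eventually_ge_atTop 3] with n hn
    rw [Complex.finrank_real_complex, zetaScale_sq hn]
  have h := tendsto_mul_measureReal_of_frontier hmeas
    ((tendsto_log_log_natCast_atTop.eventually_ge_atTop 0).mono fun n hn => by positivity)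
    hvague (by positivity) hB.1 hB.2
  rwa [one_div_mul_eq_div] at h
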